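/- **Setting.** Let $\Bbbk$ be a field of characteristic zero. For a finite-dimensional $\mathbb Z$-graded vector space $V$, let $\mathcal O(V)=\widehat S(V^\vee)$ be the graded commutative algebra of formal power series on $V$: its degree $d$ part consists of the formal sums $\sum_{n\ge 0}x_n$ with $x_n\in S^n(V^\vee)$ of degree $d$. Fix a finite-dimensional $\mathbb Z$-graded vector space $L$ with an $L_\infty[1]$-algebra structure, i.e. a degree $1$ derivation $Q_L$ of $\mathcal O(L)$ with $Q_L^2=0$, and an SH Lie pair $(L,A)$: a graded subspace $j:A\hookrightarrow L$ with an $L_\infty[1]$-algebra structure $Q_A$ such that $j^\vee\circ Q_L=Q_A\circ j^\vee$, where $j^\vee:\mathcal O(L)\to\mathcal O(A)$ is the restriction. Put $B=L/A$, so that $B^\vee=A^\perp\subset L^\vee$. Let $I^L:\mathcal O(L)\to\mathcal O(L)\otimes L^\vee$ be the algebraic de Rham operator (the derivation along the identity with $I^L(\xi)=1\otimes\xi$ for $\xi\in L^\vee$) and put $$J=(j^\vee\otimes 1)\circ I^L:\ \mathcal O(L)\to\mathcal O(A)\otimes L^\vee .$$ The canonical $A$-module structure on $B$ is dual to $D^\perp=J\circ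 Q_L|_{A^\perp}:B^\vee\to\mathcal O(A)\otimes B^\vee$. Fix also an $A$-module $E$: a $\mathbb Z$-graded vector space with a degree $1$ element $D^E\in\mathcal O(A)\otimes\mathrm{End}(E)$ such that the operator $\partial_A^E=Q_A+D^E$ on $\mathcal O(A)\otimes E$ satisfies $(\partial_A^E)^2=0$. Then $\mathcal O(A)\otimes B^\vee\otimes\mathrm{End}(E)$ is a cochain complex with differential $\partial_A=Q_A+D^\perp+[D^E,-\,]$; let $H^\bullet(A,B^\vee\otimes\mathrm{End}(E))$ be its cohomology. Let $\hbar$ be a formal parameter with $\hbar^2=0$; write $X[\hbar]=X\oplus\hbar X$ and extend all maps $\hbar$-linearly. * An *$A$-compatible infinitesimal deformation* of $Q_L$ is an operator $Q(\hbar)=Q_L+\hbar Q_+$ on $\mathcal O(L)[\hbar]$, with $Q_+$ a degree $1$ derivation of $\mathcal O(L)$, such that $Q(\hbar)^2=0$, such that $j^\vee\circ Q(\hbar)=Q_A\circ j^\vee$, and such that $J\circ Q(\hbar)=D^\perp$ on $B^\vee[\hbar]=A^\perp[\hbar]$. * Two such deformations $Q(\hbar)=Q_L+\hbar Q_+$ and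 $\bar Q(\hbar)=Q_L+\hbar\bar Q_+$ are *gauge equivalent* if there is an automorphism $\sigma=1+\hbar\lambda$ of the graded algebra $\mathcal O(L)[\hbar]$, with $\lambda:\mathcal O(L)\to\mathcal O(L)$ linear, which is the identity on the image of $\mathcal O(B)[\hbar]$, which satisfies $j^\vee\circ\sigma=j^\vee$, and for which $\sigma\circ Q(\hbar)=\bar Q(\hbar)\circ\sigma$. * Let $Q(\hbar)$ be an $A$-compatible infinitesimal deformation. An *$L[\hbar]$-connection on $E[\hbar]$ extending its $A[\hbar]$-module structure* is an operator $\nabla=Q(\hbar)+D(\hbar)$ on $(\mathcal O(L)\otimes E)[\hbar]$ with $D(\hbar)\in(\mathcal O(L)\otimes\mathrm{End}(E))[\hbar]$ of degree $1$ and $(j^\vee\otimes1)D(\hbar)=D^E$. Its *Atiyah cocycle* is $\alpha_\nabla=(J\otimes 1)(\nabla^2)\in(\mathcal O(A)\otimes B^\vee\otimes\mathrm{End}(E))[\hbar]$, where $\nabla^2$ is regarded as an element of $(\mathcal O(L)\otimes\mathrm{End}(E))[\hbar]$. The *Atiyah class* of $Q(\hbar)$ is the class $$[\alpha_\nabla]\in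 H^2\bigl(A[\hbar],B[\hbar]^\vee\otimes\mathrm{End}(E[\hbar])\bigr)\cong H^2\bigl(A,B^\vee\otimes\mathrm{End}(E)\bigr)[\hbar]$$ for any such $\nabla$. Part of the assertion below is that such $\nabla$ exist, that every $\alpha_\nabla$ is a cocycle of degree $2$, and that its class does not depend on $\nabla$. **Theorem 4.3.** Let $Q(\hbar)=Q_L+\hbar Q_+$ and $\bar Q(\hbar)=Q_L+\hbar\bar Q_+$ be two $A$-compatible infinitesimal deformations of $Q_L$. If they are gauge equivalent, then their Atiyah classes in $H^2(A,B^\vee\otimes\mathrm{End}(E))[\hbar]$ are well defined and coincide. -/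

import Mathlib

set_option maxSynthPendingDepth 3

open scoped TensorProduct DirectSum

namespace SHLie

/-! ### Graded vector spaces -/

section Graded

variable {k V W : Type*} [Field k] [AddCommGroup V] [Module k V] [AddCommGroup W] [Module k W]

/-- A linear map is homogeneous of degree `r` if it sends the degree `n` part of the source to the
degree `n + r` part of the target, for every `n`. -/
def IsHomogeneousMap (𝓥 : ℤ → Submodule k V) (𝓦 : ℤ → Submodule k W) (r : ℤ)
    (f : V →ₗ[k] W) : Prop :=
  ∀ n, ∀ v ∈ 𝓥 n, f v ∈ 𝓦 (n + r)

/-- The parity involution `v ↦ (-1)^|v| v` of a graded vector space. -/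
noncomputable def parity (𝓥 : ℤ → Submodule k V) [DirectSum.Decomposition 𝓥] : V →ₗ[k] V :=
  DirectSum.toModule k ℤ V (fun n => (-1 : k) ^ n • (𝓥 n).subtype) ∘ₗ
    (DirectSum.decomposeLinearEquiv 𝓥).toLinearMap

theorem parity_apply_of_mem (𝓥 : ℤ → Submodule k V) [DirectSum.Decomposition 𝓥] {n : ℤ} {v : V}
    (hv : v ∈ 𝓥 n) : parity 𝓥 v = (-1 : k) ^ n • v := by
  rw [parity, LinearMap.comp_apply, LinearEquiv.coe_coe, DirectSum.decomposeLinearEquiv_apply,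
    DirectSum.decompose_of_mem 𝓥 hv, ← DirectSum.lof_eq_of k, DirectSum.toModule_lof]
  rfl

theorem parity_mem (𝓥 : ℤ → Submodule k V) [DirectSum.Decomposition 𝓥] (n : ℤ) :
    ∀ v ∈ 𝓥 n, parity 𝓥 v ∈ 𝓥 n := fun v hv => by
  rw [parity_apply_of_mem 𝓥 hv]
  exact Submodule.smul_mem _ _ hv

/-- The projection onto the odd part determined by a parity involution. -/
noncomputable def oddPart (p : V →ₗ[k] V) : V →ₗ[k] V := (2 : k)⁻¹ • (LinearMap.id - p)

/-- The Koszul symmetry `v ⊗ w ↦ (-1)^(|v||w|) w ⊗ v`, for `p` and `q` the parity involutions of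
the two factors: a factor `-1` occurs exactly when both vectors are odd. -/
noncomputable def koszulSwap (p : V →ₗ[k] V) (q : W →ₗ[k] W) : V ⊗[k] W →ₗ[k] W ⊗[k] V :=
  (TensorProduct.comm k V W).toLinearMap -
    (2 : k) • (TensorProduct.map (oddPart q) (oddPart p) ∘ₗ (TensorProduct.comm k V W).toLinearMap)

/-- The grading of a tensor product of graded vector spaces. -/
def tensorGrading (𝓥 : ℤ → Submodule k V) (𝓦 : ℤ → Submodule k W) (d : ℤ) :
    Submodule k (V ⊗[k] W) :=
  Submodule.span k {x | ∃ a b : ℤ, a + b = d ∧ ∃ v ∈ 𝓥 a, ∃ w ∈ 𝓦 b, x = v ⊗ₜ[k] w}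

/-- The grading of the dual `V^∨`: its degree `n` part is the dual of the degree `-n` part of `V`,
i.e. it consists of the functionals that vanish on all other homogeneous parts of `V`. -/
def dualGrading (𝓥 : ℤ → Submodule k V) (n : ℤ) : Submodule k (Module.Dual k V) where
  carrier := {ξ | ∀ m, m ≠ -n → ∀ v ∈ 𝓥 m, ξ v = 0}
  add_mem' h₁ h₂ m hm v hv := by simp [h₁ m hm v hv, h₂ m hm v hv]
  zero_mem' m _ v _ := rfl
  smul_mem' c ξ h m hm v hv := by simp [h m hm v hv]

theorem dualMap_mem_dualGrading {𝓥 : ℤ → Submodule k V} {𝓦 : ℤ → Submodule k W} (f : V →ₗ[k] W)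
    (hf : ∀ n, ∀ v ∈ 𝓥 n, f v ∈ 𝓦 n) (n : ℤ) (ξ : Module.Dual k W) (hξ : ξ ∈ dualGrading 𝓦 n) :
    f.dualMap ξ ∈ dualGrading 𝓥 n :=
  fun m hm v hv => hξ m hm _ (hf m v hv)

/-- The functionals on a finite-dimensional graded vector space are sums of homogeneous ones. -/
theorem iSup_dualGrading [FiniteDimensional k V] (𝓥 : ℤ → Submodule k V)
    [DirectSum.Decomposition 𝓥] : ⨆ n, dualGrading 𝓥 n = ⊤ := by
  rw [eq_top_iff]
  rintro ξ -
  let pr : ℤ → V →ₗ[k] V := fun n =>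
    (𝓥 n).subtype ∘ₗ DirectSum.component k ℤ (fun i => 𝓥 i) n ∘ₗ
      (DirectSum.decomposeLinearEquiv 𝓥).toLinearMap
  have hpr : ∀ n v, pr n v = (DirectSum.decompose 𝓥 v n : V) := fun n v => rfl
  have hfin : {n | 𝓥 n ≠ ⊥}.Finite :=
    WellFoundedGT.finite_ne_bot_of_iSupIndep
      (DirectSum.Decomposition.isInternal 𝓥).submodule_iSupIndep
  have hsum : ξ = ∑ n ∈ hfin.toFinset, ξ ∘ₗ pr n := by
    ext v
    classical
    conv_lhs => rw [← DirectSum.sum_support_decompose 𝓥 v]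
    simp only [map_sum, LinearMap.coe_sum, Finset.sum_apply, LinearMap.comp_apply, hpr]
    refine Finset.sum_subset (fun n hn => ?_) (fun n _ hn => ?_)
    · simp only [Set.Finite.mem_toFinset, Set.mem_ofPred_eq]
      intro h
      have h0 : (DirectSum.decompose 𝓥 v n : V) = 0 := by
        have := h.le (DirectSum.decompose 𝓥 v n).2
        simpa using this
      exact (DFinsupp.mem_support_iff.1 hn) (Subtype.ext h0)
    · have : DirectSum.decompose 𝓥 v n = 0 := by simpa using hn
      simp [this]
  rw [hsum]
  refine Submodule.sum_mem _ fun n _ => Submodule.mem_iSup_of_mem (-n) ?_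
  intro m hm v hv
  have hm' : m ≠ n := by simpa using hm
  simp [hpr, DirectSum.decompose_of_mem_ne 𝓥 hv hm']

end Graded

/-! ### The graded symmetric algebra and its completion -/

section Symmetric

variable {k V W : Type*} [Field k] [AddCommGroup V] [Module k V] [AddCommGroup W] [Module k W]

/-- The Koszul commutation relations `v ⊙ w = (-1)^(|v||w|) w ⊙ v`. -/
inductive GSymRel (𝓥 : ℤ → Submodule k V) : TensorAlgebra k V → TensorAlgebra k V → Prop
  | comm {m n : ℤ} {v w : V} (hv : v ∈ 𝓥 m) (hw : w ∈ 𝓥 n) :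
      GSymRel 𝓥 (TensorAlgebra.ι k v * TensorAlgebra.ι k w)
        ((-1 : k) ^ (m * n) • (TensorAlgebra.ι k w * TensorAlgebra.ι k v))

/-- The graded symmetric algebra `S(V)`. -/
def GSym (𝓥 : ℤ → Submodule k V) : Type _ := RingQuot (GSymRel 𝓥)

noncomputable instance (𝓥 : ℤ → Submodule k V) : Ring (GSym 𝓥) :=
  inferInstanceAs (Ring (RingQuot (GSymRel 𝓥)))

noncomputable instance (𝓥 : ℤ → Submodule k V) : Algebra k (GSym 𝓥) :=
  inferInstanceAs (Algebra k (RingQuot (GSymRel 𝓥)))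

namespace GSym

/-- The inclusion `V → S(V)`. -/
noncomputable def ι (𝓥 : ℤ → Submodule k V) : V →ₗ[k] GSym 𝓥 :=
  (RingQuot.mkAlgHom k (GSymRel 𝓥)).toLinearMap ∘ₗ TensorAlgebra.ι k

theorem ι_mul_ι {𝓥 : ℤ → Submodule k V} {m n : ℤ} {v w : V} (hv : v ∈ 𝓥 m) (hw : w ∈ 𝓥 n) :
    ι 𝓥 v * ι 𝓥 w = (-1 : k) ^ (m * n) • (ι 𝓥 w * ι 𝓥 v) := by
  have h := RingQuot.mkAlgHom_rel k (GSymRel.comm hv hw)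
  rw [map_smul, map_mul, map_mul] at h
  exact h

/-- The universal property of `S(V)`. -/
noncomputable def lift {R : Type*} [Ring R] [Algebra k R] (𝓥 : ℤ → Submodule k V) (f : V →ₗ[k] R)
    (hf : ∀ (m n : ℤ) (v w : V), v ∈ 𝓥 m → w ∈ 𝓥 n →
      f v * f w = (-1 : k) ^ (m * n) • (f w * f v)) : GSym 𝓥 →ₐ[k] R :=
  RingQuot.liftAlgHom k ⟨TensorAlgebra.lift k f, by
    rintro _ _ ⟨hv, hw⟩
    simpa using hf _ _ _ _ hv hw⟩

theorem lift_ι {R : Type*} [Ring R] [Algebra k R] (𝓥 : ℤ → Submodule k V) (f : V →ₗ[k] R)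
    (hf : ∀ (m n : ℤ) (v w : V), v ∈ 𝓥 m → w ∈ 𝓥 n →
      f v * f w = (-1 : k) ^ (m * n) • (f w * f v)) (v : V) : lift 𝓥 f hf (ι 𝓥 v) = f v := by
  have h := RingQuot.liftAlgHom_mkAlgHom_apply k (TensorAlgebra.lift k f)
    (s := GSymRel 𝓥) (by
      rintro _ _ ⟨hv, hw⟩
      simpa using hf _ _ _ _ hv hw) (TensorAlgebra.ι k v)
  rw [TensorAlgebra.lift_ι_apply] at h
  exact h

/-- The algebra morphism `S(V) → S(W)` induced by a linear map `V → W` of degree `0`. -/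
noncomputable def map {𝓥 : ℤ → Submodule k V} {𝓦 : ℤ → Submodule k W} (f : V →ₗ[k] W)
    (hf : ∀ n, ∀ v ∈ 𝓥 n, f v ∈ 𝓦 n) : GSym 𝓥 →ₐ[k] GSym 𝓦 :=
  lift 𝓥 (ι 𝓦 ∘ₗ f) fun _ _ _ _ hv hw => ι_mul_ι (hf _ _ hv) (hf _ _ hw)

/-- The part `S^n(V)^d` of `S(V)` of symmetric power `n` and of degree `d`, spanned by the products
`v₁ ⊙ ⋯ ⊙ vₙ` of homogeneous vectors with `|v₁| + ⋯ + |vₙ| = d`. -/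
noncomputable def piece (𝓥 : ℤ → Submodule k V) (n : ℕ) (d : ℤ) : Submodule k (GSym 𝓥) :=
  Submodule.span k {x | ∃ l : List (V × ℤ), l.length = n ∧ (∀ p ∈ l, p.1 ∈ 𝓥 p.2) ∧
    (l.map Prod.snd).sum = d ∧ x = (l.map fun p => ι 𝓥 p.1).prod}

theorem mul_mem_piece {𝓥 : ℤ → Submodule k V} {m n : ℕ} {c d : ℤ} {x y : GSym 𝓥}
    (hx : x ∈ piece 𝓥 m c) (hy : y ∈ piece 𝓥 n d) : x * y ∈ piece 𝓥 (m + n) (c + d) := by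
  have h := Submodule.mul_mem_mul hx hy
  rw [piece, piece, Submodule.span_mul_span] at h
  refine Submodule.span_mono ?_ h
  rintro _ ⟨_, ⟨l, rfl, hl, rfl, rfl⟩, _, ⟨l', rfl, hl', rfl, rfl⟩, rfl⟩
  refine ⟨l ++ l', by simp, ?_, by simp, by simp⟩
  intro p hp
  rcases List.mem_append.1 hp with h | h
  exacts [hl p h, hl' p h]

theorem one_mem_piece (𝓥 : ℤ → Submodule k V) : (1 : GSym 𝓥) ∈ piece 𝓥 0 0 :=
  Submodule.subset_span ⟨[], by simp⟩

theorem ι_mem_piece {𝓥 : ℤ → Submodule k V} {n : ℤ} {v : V} (hv : v ∈ 𝓥 n) :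
    ι 𝓥 v ∈ piece 𝓥 1 n :=
  Submodule.subset_span ⟨[(v, n)], by simpa using hv⟩

theorem map_mem_piece {𝓥 : ℤ → Submodule k V} {𝓦 : ℤ → Submodule k W} (f : V →ₗ[k] W)
    (hf : ∀ n, ∀ v ∈ 𝓥 n, f v ∈ 𝓦 n) {n : ℕ} {d : ℤ} {x : GSym 𝓥} (hx : x ∈ piece 𝓥 n d) :
    map f hf x ∈ piece 𝓦 n d := by
  induction hx using Submodule.span_induction with
  | mem x hx =>
    obtain ⟨l, hl, hl', hd, rfl⟩ := hx
    refine Submodule.subset_span ⟨l.map fun p => (f p.1, p.2), by simpa using hl, ?_, ?_, ?_⟩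
    · intro p hp
      obtain ⟨q, hq, rfl⟩ := List.mem_map.1 hp
      exact hf _ _ (hl' q hq)
    · simpa [Function.comp_def] using hd
    · simp [map_list_prod, Function.comp_def, map, lift_ι]
  | zero => simp
  | add x y _ _ hx hy => simpa using add_mem hx hy
  | smul c x _ hx => simpa using Submodule.smul_mem _ c hx

end GSym

/-- The elements of degree `d` of the completed symmetric algebra: the formal sums `∑ₙ xₙ` with
`xₙ ∈ S^n(V)^d`. Such a sum is stored as the power series `∑ₙ xₙ Tⁿ`. -/
noncomputable def homogeneousSeries (𝓥 : ℤ → Submodule k V) (d : ℤ) : Submodule k (PowerSeries (GSym 𝓥)) where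
  carrier := {f | ∀ n, PowerSeries.coeff n f ∈ GSym.piece 𝓥 n d}
  add_mem' hf hg n := by simpa using add_mem (hf n) (hg n)
  zero_mem' n := by simp
  smul_mem' c f hf n := Submodule.smul_mem _ c (hf n)

/-- The completed graded symmetric algebra `Ŝ(V) = ∏ₙ S^n(V)`, the product being that of graded
vector spaces: `Ŝ(V)` is the direct sum over `d` of its homogeneous parts `∏ₙ S^n(V)^d`. -/
noncomputable def cSymSubalgebra (𝓥 : ℤ → Submodule k V) : Subalgebra k (PowerSeries (GSym 𝓥)) :=
  (⨆ d, homogeneousSeries 𝓥 d).toSubalgebra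
    (Submodule.mem_iSup_of_mem 0 fun n => by
      rcases n with _ | n
      · simpa using GSym.one_mem_piece 𝓥
      · simp [PowerSeries.coeff_one])
    (fun x y hx hy => by
      induction hx using Submodule.iSup_induction' with
      | zero => simp
      | add x x' _ _ hx hx' => rw [add_mul]; exact add_mem hx hx'
      | mem c x hx =>
        induction hy using Submodule.iSup_induction' with
        | zero => simp
        | add y y' _ _ hy hy' => rw [mul_add]; exact add_mem hy hy'
        | mem d y hy =>
          refine Submodule.mem_iSup_of_mem (c + d) fun n => ?_
          rw [PowerSeries.coeff_mul]
          refine Submodule.sum_mem _ fun p hp => ?_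
          rw [← Finset.HasAntidiagonal.mem_antidiagonal.1 hp]
          exact GSym.mul_mem_piece (hx _) (hy _))

/-- The completed graded symmetric algebra `Ŝ(V)`, as a type. -/
def CSym (𝓥 : ℤ → Submodule k V) : Type _ := cSymSubalgebra 𝓥

noncomputable instance (𝓥 : ℤ → Submodule k V) : Ring (CSym 𝓥) :=
  inferInstanceAs (Ring (cSymSubalgebra 𝓥))

noncomputable instance (𝓥 : ℤ → Submodule k V) : Algebra k (CSym 𝓥) :=
  inferInstanceAs (Algebra k (cSymSubalgebra 𝓥))

namespace CSym

/-- An element of `Ŝ(V)`, as a power series. -/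
noncomputable def val (𝓥 : ℤ → Submodule k V) : CSym 𝓥 →ₐ[k] PowerSeries (GSym 𝓥) :=
  (cSymSubalgebra 𝓥).val

theorem val_injective (𝓥 : ℤ → Submodule k V) : Function.Injective (val 𝓥) :=
  Subtype.val_injective

theorem val_mem (𝓥 : ℤ → Submodule k V) (x : CSym 𝓥) : val 𝓥 x ∈ cSymSubalgebra 𝓥 := x.2

theorem mem_of_mem_homogeneousSeries {𝓥 : ℤ → Submodule k V} {d : ℤ} {x : PowerSeries (GSym 𝓥)}
    (hx : x ∈ homogeneousSeries 𝓥 d) : x ∈ cSymSubalgebra 𝓥 :=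
  Submodule.mem_iSup_of_mem d hx

/-- A linear map with values in the power series that belong to `Ŝ(V)`, as a map into `Ŝ(V)`. -/
noncomputable def codRestrict (𝓥 : ℤ → Submodule k V) (F : W →ₗ[k] PowerSeries (GSym 𝓥))
    (hF : ∀ w, F w ∈ cSymSubalgebra 𝓥) : W →ₗ[k] CSym 𝓥 :=
  LinearMap.codRestrict (Subalgebra.toSubmodule (cSymSubalgebra 𝓥)) F hF

/-- A linear map between power series maps `Ŝ(V)` to `Ŝ(W)` if it maps all homogeneous elements of
`Ŝ(V)` to `Ŝ(W)`. -/
theorem apply_mem {𝓥 : ℤ → Submodule k V} {𝓦 : ℤ → Submodule k W}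
    (F : PowerSeries (GSym 𝓥) →ₗ[k] PowerSeries (GSym 𝓦))
    (hF : ∀ d, ∀ x ∈ homogeneousSeries 𝓥 d, F x ∈ cSymSubalgebra 𝓦) (x : CSym 𝓥) :
    F (val 𝓥 x) ∈ cSymSubalgebra 𝓦 := by
  have h : (⨆ d, homogeneousSeries 𝓥 d) ≤
      (Subalgebra.toSubmodule (cSymSubalgebra 𝓦)).comap F := iSup_le fun d x hx => hF d x hx
  exact h x.2

/-- The degree `d` part of `Ŝ(V)`. -/
noncomputable def deg (𝓥 : ℤ → Submodule k V) (d : ℤ) : Submodule k (CSym 𝓥) :=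
  (homogeneousSeries 𝓥 d).comap (val 𝓥).toLinearMap

/-- The algebra morphism `Ŝ(V) → Ŝ(W)` induced by a linear map `V → W` of degree `0`. -/
noncomputable def map {𝓥 : ℤ → Submodule k V} {𝓦 : ℤ → Submodule k W} (f : V →ₗ[k] W)
    (hf : ∀ n, ∀ v ∈ 𝓥 n, f v ∈ 𝓦 n) : CSym 𝓥 →ₐ[k] CSym 𝓦 :=
  ((PowerSeries.mapAlgHom (GSym.map f hf)).comp (val 𝓥)).codRestrict (cSymSubalgebra 𝓦)
    (apply_mem (PowerSeries.mapAlgHom (GSym.map f hf)).toLinearMap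
      fun d y hy => mem_of_mem_homogeneousSeries (d := d) fun n => by
        simpa [PowerSeries.mapAlgHom_apply] using GSym.map_mem_piece f hf (hy n))

end CSym

end Symmetric

/-! ### Formal power series on a graded vector space, contractions -/

section Functions

variable {k L M : Type*} [Field k] [AddCommGroup L] [Module k L] [AddCommGroup M] [Module k M]

/-- The algebra `O(L) = Ŝ(L^∨)` of formal power series on the graded vector space `L`. -/
abbrev O (𝓛 : ℤ → Submodule k L) : Type _ := CSym (dualGrading 𝓛)

namespace O

/-- The pull-back `f^∨ : O(L) → O(M)` along a linear map `f : M → L` of degree `0`. -/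
noncomputable def pullback {𝓜 : ℤ → Submodule k M} {𝓛 : ℤ → Submodule k L} (f : M →ₗ[k] L)
    (hf : ∀ n, ∀ v ∈ 𝓜 n, f v ∈ 𝓛 n) : O 𝓛 →ₐ[k] O 𝓜 :=
  CSym.map f.dualMap (dualMap_mem_dualGrading f hf)

variable (𝓛 : ℤ → Submodule k L)

/-- The inclusion `L^∨ → O(L)`. -/
noncomputable def gen [DirectSum.Decomposition 𝓛] [FiniteDimensional k L] :
    Module.Dual k L →ₗ[k] O 𝓛 :=
  CSym.codRestrict (dualGrading 𝓛)
    ({ toFun := fun s => PowerSeries.monomial 1 s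
       map_add' := by simp
       map_smul' := fun c s => by
        ext n
        simp only [PowerSeries.coeff_monomial, RingHom.id_apply]
        change _ = c • PowerSeries.coeff n (PowerSeries.monomial 1 s)
        rw [PowerSeries.coeff_monomial]
        split_ifs <;> simp } ∘ₗ GSym.ι (dualGrading 𝓛))
    (fun ξ => by
      have hξ : ξ ∈ ⨆ n, dualGrading 𝓛 n := by
        rw [iSup_dualGrading]
        trivial
      induction hξ using Submodule.iSup_induction' with
      | zero => simp
      | add x y _ _ hx hy => rw [map_add]; exact add_mem hx hy
      | mem n ξ hξ =>
        refine CSym.mem_of_mem_homogeneousSeries (d := n) fun m => ?_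
        change PowerSeries.coeff m (PowerSeries.monomial 1 (GSym.ι (dualGrading 𝓛) ξ)) ∈ _
        rw [PowerSeries.coeff_monomial]
        split_ifs with h
        · rw [h]
          exact GSym.ι_mem_piece hξ
        · exact zero_mem _)

end O

variable (𝓛 : ℤ → Submodule k L) [DirectSum.Decomposition 𝓛]

theorem dual_parity_apply {n : ℤ} {ξ : Module.Dual k L} (hξ : ξ ∈ dualGrading 𝓛 n) (v : L) :
    ξ (parity 𝓛 v) = (-1 : k) ^ n * ξ v := by
  induction v using DirectSum.Decomposition.inductionOn 𝓛 with
  | zero => simp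
  | @homogeneous m v =>
    rw [parity_apply_of_mem 𝓛 v.2, map_smul, smul_eq_mul]
    by_cases hm : m = -n
    · have : (-1 : k) ^ m = (-1 : k) ^ n := by
        rw [hm, zpow_neg, ← inv_zpow, inv_neg, inv_one]
      rw [this]
    · rw [hξ m hm v v.2, mul_zero, mul_zero]
  | add v w hv hw => rw [map_add, map_add, hv, hw, map_add, mul_add]

namespace GSym

/-- The parity involution of `S(L^∨)`. -/
noncomputable def par : GSym (dualGrading 𝓛) →ₐ[k] GSym (dualGrading 𝓛) :=
  map (parity 𝓛).dualMap (dualMap_mem_dualGrading _ (parity_mem 𝓛))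

theorem par_ι {n : ℤ} {ξ : Module.Dual k L} (hξ : ξ ∈ dualGrading 𝓛 n) :
    par 𝓛 (ι (dualGrading 𝓛) ξ) = (-1 : k) ^ n • ι (dualGrading 𝓛) ξ := by
  rw [par, map, lift_ι, LinearMap.comp_apply, ← map_smul]
  congr 1
  ext v
  simpa using dual_parity_apply 𝓛 hξ v

theorem par_mem_piece {n : ℕ} {d : ℤ} {x : GSym (dualGrading 𝓛)}
    (hx : x ∈ piece (dualGrading 𝓛) n d) : par 𝓛 x ∈ piece (dualGrading 𝓛) n d :=
  map_mem_piece _ _ hx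

/-- The operator `s ↦ (-1)^(|v||s|) ξ(v) s` on `S(L^∨)`. -/
noncomputable def signedEval (v : L) : Module.Dual k L →ₗ[k] Module.End k (GSym (dualGrading 𝓛)) where
  toFun ξ := ξ (v - oddPart (parity 𝓛) v) • LinearMap.id +
    ξ (oddPart (parity 𝓛) v) • (par 𝓛).toLinearMap
  map_add' ξ η := by
    simp only [LinearMap.add_apply, add_smul]
    abel
  map_smul' c ξ := by
    simp only [LinearMap.smul_apply, smul_eq_mul, mul_smul, RingHom.id_apply, smul_add]

theorem signedEval_apply [CharZero k] (v : L) {n : ℤ} {ξ : Module.Dual k L}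
    (hξ : ξ ∈ dualGrading 𝓛 n) (s : GSym (dualGrading 𝓛)) :
    signedEval 𝓛 v ξ s = ξ v • (if Even n then s else par 𝓛 s) := by
  have h2 : (2 : k) ≠ 0 := two_ne_zero
  simp only [signedEval, LinearMap.coe_mk, AddHom.coe_mk, LinearMap.add_apply, LinearMap.smul_apply,
    LinearMap.id_apply, AlgHom.toLinearMap_apply, oddPart, LinearMap.sub_apply, map_sub, map_smul,
    dual_parity_apply 𝓛 hξ, smul_eq_mul]
  split_ifs with h
  · rw [h.neg_one_zpow]
    simp
  · rw [(Int.not_even_iff_odd.1 h).neg_one_zpow]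
    have : (2 : k)⁻¹ * (ξ v - -1 * ξ v) = ξ v := by field_simp; ring
    rw [this, sub_self, zero_smul, zero_add]

/-- The operators `(m, s) ↦ (ξ ⊙ m + (-1)^(|v||s|) ξ(v) s, ξ ⊙ s)` on pairs of elements of
`S(L^∨)`, for `ξ ∈ L^∨`. -/
noncomputable def contractGen (v : L) : Module.Dual k L →ₗ[k]
    Module.End k (GSym (dualGrading 𝓛) × GSym (dualGrading 𝓛)) where
  toFun ξ := LinearMap.prod
    (LinearMap.mulLeft k (ι (dualGrading 𝓛) ξ) ∘ₗ LinearMap.fst k _ _ +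
      signedEval 𝓛 v ξ ∘ₗ LinearMap.snd k _ _)
    (LinearMap.mulLeft k (ι (dualGrading 𝓛) ξ) ∘ₗ LinearMap.snd k _ _)
  map_add' ξ η := by
    refine LinearMap.ext fun x => Prod.ext ?_ ?_
    · simp [add_mul]; abel
    · simp [add_mul]
  map_smul' c ξ := by
    refine LinearMap.ext fun x => Prod.ext ?_ ?_ <;> simp

theorem contractGen_apply (v : L) (ξ : Module.Dual k L)
    (x : GSym (dualGrading 𝓛) × GSym (dualGrading 𝓛)) :
    contractGen 𝓛 v ξ x =
      (ι (dualGrading 𝓛) ξ * x.1 + signedEval 𝓛 v ξ x.2, ι (dualGrading 𝓛) ξ * x.2) := rfl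

theorem contractGen_comm [CharZero k] (v : L) (m n : ℤ) (ξ η : Module.Dual k L)
    (hξ : ξ ∈ dualGrading 𝓛 m) (hη : η ∈ dualGrading 𝓛 n) :
    contractGen 𝓛 v ξ * contractGen 𝓛 v η =
      (-1 : k) ^ (m * n) • (contractGen 𝓛 v η * contractGen 𝓛 v ξ) := by
  have hp : ∀ {n : ℤ} {η : Module.Dual k L}, η ∈ dualGrading 𝓛 n → ∀ s,
      par 𝓛 (ι (dualGrading 𝓛) η * s) = (-1 : k) ^ n • (ι (dualGrading 𝓛) η * par 𝓛 s) := by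
    intro n η hη s
    rw [map_mul, par_ι 𝓛 hη, smul_mul_assoc]
  have hc : ∀ s, ι (dualGrading 𝓛) ξ * (ι (dualGrading 𝓛) η * s) =
      (-1 : k) ^ (m * n) • (ι (dualGrading 𝓛) η * (ι (dualGrading 𝓛) ξ * s)) := by
    intro s
    rw [← mul_assoc, ι_mul_ι hξ hη, smul_mul_assoc, mul_assoc]
  refine LinearMap.ext fun x => Prod.ext ?_ ?_
  · simp only [Module.End.mul_apply, contractGen_apply, LinearMap.smul_apply, Prod.smul_fst,
      signedEval_apply 𝓛 v hξ, signedEval_apply 𝓛 v hη, mul_add, smul_add, hc, add_assoc,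
      add_right_inj]
    rcases Int.even_or_odd m with hm | hm <;> rcases Int.even_or_odd n with hn | hn
    · simp [hm, hn, (hm.mul_right n).neg_one_zpow, add_comm]
    · simp [hm, Int.not_even_iff_odd.2 hn, (hm.mul_right n).neg_one_zpow, add_comm, hp hξ,
        hm.neg_one_zpow]
    · simp [hn, Int.not_even_iff_odd.2 hm, (hn.mul_left m).neg_one_zpow, add_comm, hp hη,
        hn.neg_one_zpow]
    · simp [Int.not_even_iff_odd.2 hm, Int.not_even_iff_odd.2 hn, (hm.mul hn).neg_one_zpow,
        add_comm, hp hη, hp hξ, hn.neg_one_zpow, hm.neg_one_zpow]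
  · simp only [Module.End.mul_apply, contractGen_apply, LinearMap.smul_apply, Prod.smul_snd, hc]

/-- The right contraction `x ↦ x ⌞ v` on `S(L^∨)` by a vector `v ∈ L`. It is read off from the
action of `S(L^∨)` on pairs generated by the above operators: `x` sends `(0, 1)` to `(x ⌞ v, x)`. -/
noncomputable def contract [CharZero k] (v : L) :
    GSym (dualGrading 𝓛) →ₗ[k] GSym (dualGrading 𝓛) :=
  LinearMap.fst k _ _ ∘ₗ LinearMap.applyₗ (0, 1) ∘ₗ
    (lift (dualGrading 𝓛) (contractGen 𝓛 v) (contractGen_comm 𝓛 v)).toLinearMap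

section

variable [CharZero k]

theorem lift_contractGen_snd (v : L) (l : List (Module.Dual k L × ℤ)) :
    (lift (dualGrading 𝓛) (contractGen 𝓛 v) (contractGen_comm 𝓛 v)
      (l.map fun p => ι (dualGrading 𝓛) p.1).prod (0, 1)).2 =
        (l.map fun p => ι (dualGrading 𝓛) p.1).prod := by
  induction l with
  | nil => simp
  | cons p l ih => simp [lift_ι, contractGen_apply, ih]

/-- The recursion `(ξ ⊙ s) ⌞ v = ξ ⊙ (s ⌞ v) + (-1)^(|v||s|) ξ(v) s` for the right contraction of a
product of elements of `L^∨`. -/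
theorem contract_cons (v : L) (p : Module.Dual k L × ℤ) (l : List (Module.Dual k L × ℤ)) :
    contract 𝓛 v ((p :: l).map fun p => ι (dualGrading 𝓛) p.1).prod =
      ι (dualGrading 𝓛) p.1 * contract 𝓛 v (l.map fun p => ι (dualGrading 𝓛) p.1).prod +
        signedEval 𝓛 v p.1 (l.map fun p => ι (dualGrading 𝓛) p.1).prod := by
  conv_rhs => rw [← lift_contractGen_snd 𝓛 v l]
  simp [contract, lift_ι, contractGen_apply, lift_contractGen_snd]

theorem contract_nil (v : L) :
    contract 𝓛 v (([] : List (Module.Dual k L × ℤ)).map fun p => ι (dualGrading 𝓛) p.1).prod =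
      0 := by
  simp [contract]

theorem contract_zero_left {n : ℕ} {d : ℤ} {x : GSym (dualGrading 𝓛)}
    (hx : x ∈ piece (dualGrading 𝓛) n d) : contract 𝓛 0 x = 0 := by
  induction hx using Submodule.span_induction with
  | mem x hx =>
    obtain ⟨l, -, -, -, rfl⟩ := hx
    induction l with
    | nil => exact contract_nil 𝓛 0
    | cons p l ih => rw [contract_cons, ih]; simp [signedEval]
  | zero => simp
  | add x y _ _ hx hy => rw [map_add, hx, hy, add_zero]
  | smul c x _ hx => rw [map_smul, hx, smul_zero]

theorem contract_add_left (v w : L) {n : ℕ} {d : ℤ} {x : GSym (dualGrading 𝓛)}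
    (hx : x ∈ piece (dualGrading 𝓛) n d) :
    contract 𝓛 (v + w) x = contract 𝓛 v x + contract 𝓛 w x := by
  induction hx using Submodule.span_induction with
  | mem x hx =>
    obtain ⟨l, -, -, -, rfl⟩ := hx
    induction l with
    | nil => simp only [contract_nil, add_zero]
    | cons p l ih =>
      rw [contract_cons, ih, contract_cons, contract_cons]
      simp [signedEval, mul_add, add_smul, sub_smul]
      abel
  | zero => simp
  | add x y _ _ hx hy => rw [map_add, hx, hy, map_add, map_add]; abel
  | smul c x _ hx => rw [map_smul, hx, map_smul, map_smul, smul_add]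

theorem contract_mem_piece {m : ℤ} {v : L} (hv : v ∈ 𝓛 m) {n : ℕ} {d : ℤ}
    {x : GSym (dualGrading 𝓛)} (hx : x ∈ piece (dualGrading 𝓛) (n + 1) d) :
    contract 𝓛 v x ∈ piece (dualGrading 𝓛) n (d + m) := by
  induction hx using Submodule.span_induction with
  | mem x hx =>
    obtain ⟨l, hl, hp, rfl, rfl⟩ := hx
    induction l generalizing n with
    | nil => simp at hl
    | cons p l ih =>
      have hp1 := hp p (by simp)
      have hp2 : ∀ q ∈ l, q.1 ∈ dualGrading 𝓛 q.2 := fun q hq => hp q (by simp [hq])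
      have hl1 : l.length = n := by simpa using hl
      rw [contract_cons]
      refine add_mem ?_ ?_
      · rcases n with _ | n
        · obtain rfl : l = [] := by simpa using hl1
          rw [contract_nil, mul_zero]
          exact zero_mem _
        · have h := mul_mem_piece (ι_mem_piece hp1) (ih hl1 hp2)
          rw [add_comm 1 n] at h
          simpa [add_assoc] using h
      · rw [signedEval_apply 𝓛 v hp1]
        by_cases h0 : m = -p.2
        · have hs : (l.map fun p => ι (dualGrading 𝓛) p.1).prod ∈
              piece (dualGrading 𝓛) n (((p :: l).map Prod.snd).sum + m) :=
            Submodule.subset_span ⟨l, hl1, hp2, by simp [h0], rfl⟩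
          refine Submodule.smul_mem _ _ ?_
          split_ifs
          exacts [hs, par_mem_piece 𝓛 hs]
        · rw [hp1 m h0 v hv, zero_smul]
          exact zero_mem _
  | zero => simp
  | add x y _ _ hx hy => rw [map_add]; exact add_mem hx hy
  | smul c x _ hx => rw [map_smul]; exact Submodule.smul_mem _ _ hx

end

end GSym

namespace O

variable [CharZero k]

/-- The right contraction `f ⌞ v` of formal sums, computed term by term. -/
noncomputable def contractSeries (v : L) :
    PowerSeries (GSym (dualGrading 𝓛)) →ₗ[k] PowerSeries (GSym (dualGrading 𝓛)) where
  toFun f := PowerSeries.mk fun n => GSym.contract 𝓛 v (PowerSeries.coeff (n + 1) f)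
  map_add' f g := by ext n; simp
  map_smul' c f := by
    have hc : ∀ (g : PowerSeries (GSym (dualGrading 𝓛))) n,
        PowerSeries.coeff n (c • g) = c • PowerSeries.coeff n g := fun _ _ => rfl
    ext n
    rw [RingHom.id_apply, hc, PowerSeries.coeff_mk, PowerSeries.coeff_mk, hc, map_smul]

theorem coeff_contractSeries (v : L) (f : PowerSeries (GSym (dualGrading 𝓛))) (n : ℕ) :
    PowerSeries.coeff n (contractSeries 𝓛 v f) =
      GSym.contract 𝓛 v (PowerSeries.coeff (n + 1) f) := by
  simp [contractSeries]

theorem contractSeries_mem (v : L) (d : ℤ) (f : PowerSeries (GSym (dualGrading 𝓛)))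
    (hf : f ∈ homogeneousSeries (dualGrading 𝓛) d) :
    contractSeries 𝓛 v f ∈ cSymSubalgebra (dualGrading 𝓛) := by
  induction v using DirectSum.Decomposition.inductionOn 𝓛 with
  | zero =>
    have : contractSeries 𝓛 0 f = 0 := by
      ext n
      rw [coeff_contractSeries, GSym.contract_zero_left 𝓛 (hf _), map_zero]
    rw [this]
    exact zero_mem _
  | @homogeneous m v =>
    refine CSym.mem_of_mem_homogeneousSeries (d := d + m) fun n => ?_
    rw [coeff_contractSeries]
    exact GSym.contract_mem_piece 𝓛 v.2 (hf _)
  | add v w hv hw =>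
    have : contractSeries 𝓛 (v + w) f = contractSeries 𝓛 v f + contractSeries 𝓛 w f := by
      ext n
      rw [map_add, coeff_contractSeries, coeff_contractSeries, coeff_contractSeries,
        GSym.contract_add_left 𝓛 _ _ (hf _)]
    rw [this]
    exact add_mem hv hw

/-- The right contraction `f ↦ f ⌞ v` on `O(L)` by a vector `v ∈ L`. -/
noncomputable def contract (v : L) : O 𝓛 →ₗ[k] O 𝓛 :=
  CSym.codRestrict (dualGrading 𝓛)
    (contractSeries 𝓛 v ∘ₗ (CSym.val (dualGrading 𝓛)).toLinearMap)
    (CSym.apply_mem (contractSeries 𝓛 v) (contractSeries_mem 𝓛 v))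

/-- The algebraic de Rham operator `I : O(L) → O(L) ⊗ L^∨`, that is `f ↦ ∑ᵢ (f ⌞ eᵢ) ⊗ eⁱ` for any
basis `(eᵢ)` of `L`, with dual basis `(eⁱ)`. -/
noncomputable def deRham [FiniteDimensional k L] : O 𝓛 →ₗ[k] O 𝓛 ⊗[k] Module.Dual k L :=
  ∑ i, (TensorProduct.mk k (O 𝓛) (Module.Dual k L)).flip ((Module.finBasis k L).coord i) ∘ₗ
    contract 𝓛 (Module.finBasis k L i)

end O

end Functions

/-! ### Derivations and connections -/

section Connections

variable {k L M E : Type*} [Field k] [AddCommGroup L] [Module k L] [AddCommMonoid M] [Module k M]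
  [AddCommGroup E] [Module k E]

/-- Derivations of degree `r` of the graded algebra `O(L)`. -/
structure IsDerivation (𝓛 : ℤ → Submodule k L) (r : ℤ) (D : O 𝓛 →ₗ[k] O 𝓛) : Prop where
  degree : IsHomogeneousMap (CSym.deg (dualGrading 𝓛)) (CSym.deg (dualGrading 𝓛)) r D
  leibniz : ∀ d, ∀ x ∈ CSym.deg (dualGrading 𝓛) d, ∀ y,
    D (x * y) = D x * y + (-1 : k) ^ (r * d) • (x * D y)

/-- Homological vector fields on `L`, i.e. `L_∞[1]`-algebra structures on `L`: derivations of `O(L)`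
of degree `1` and of square zero. -/
structure IsHomologicalVectorField (𝓛 : ℤ → Submodule k L) (Q : O 𝓛 →ₗ[k] O 𝓛) : Prop where
  derivation : IsDerivation 𝓛 1 Q
  square_zero : Q ∘ₗ Q = 0

/-- The operator `ω ⊗ e ↦ (-1)^|ω| ω · F(e)`, where `τ` is the parity involution of `O(L)`, for
`F` with values in an `O(L)`-module `M`. -/
noncomputable def signedExtension {𝓛 : ℤ → Submodule k L} (τ : O 𝓛 →ₗ[k] O 𝓛)
    [Module (O 𝓛) M] [IsScalarTower k (O 𝓛) M] (F : E →ₗ[k] M) : O 𝓛 ⊗[k] E →ₗ[k] M :=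
  TensorProduct.lift ((Algebra.lsmul k k M).toLinearMap.compl₁₂ τ F)

theorem signedExtension_tmul {𝓛 : ℤ → Submodule k L} (τ : O 𝓛 →ₗ[k] O 𝓛)
    [Module (O 𝓛) M] [IsScalarTower k (O 𝓛) M] (F : E →ₗ[k] M) (ω : O 𝓛) (e : E) :
    signedExtension τ F (ω ⊗ₜ e) = τ ω • F e := rfl

/-- The operator `Q + D` on `O(L) ⊗ E`, i.e. `ω ⊗ e ↦ Q(ω) ⊗ e + (-1)^|ω| ω · D(e)`, where `τ` is
the parity involution of `O(L)`. -/
noncomputable def connection {𝓛 : ℤ → Submodule k L} (τ : O 𝓛 →ₗ[k] O 𝓛) (Q : O 𝓛 →ₗ[k] O 𝓛)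
    (D : E →ₗ[k] O 𝓛 ⊗[k] E) : O 𝓛 ⊗[k] E →ₗ[k] O 𝓛 ⊗[k] E :=
  Q.rTensor E + signedExtension τ D

/-- The degree `d` part of `U ⊗ End(E)`, where `End(E)` is graded by the degrees of homogeneous
endomorphisms; an element `u ⊗ φ` is regarded as the map `E → U ⊗ E`, `e ↦ u ⊗ φ(e)`. -/
def endTensor (𝓤 : ℤ → Submodule k M) (𝓔 : ℤ → Submodule k E) (d : ℤ) :
    Submodule k (E →ₗ[k] M ⊗[k] E) :=
  Submodule.span k {Φ | ∃ a b : ℤ, a + b = d ∧ ∃ u ∈ 𝓤 a, ∃ φ : E →ₗ[k] E,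
    IsHomogeneousMap 𝓔 𝓔 b φ ∧ Φ = TensorProduct.mk k M E u ∘ₗ φ}

end Connections

/-! ### Cohomology, and the square zero parameter `ħ`

For a vector space `X` we write `X[ħ] = X ⊕ ħ X` as `DualNumber X`. A `k[ħ]`-linear map
`X[ħ] → Y[ħ]` is the same as an element `P₀ + ħ P₁` of `Hom(X, Y)[ħ]`. -/

section Eps

variable {k X Y : Type*} [Field k] [AddCommGroup X] [Module k X] [AddCommGroup Y] [Module k Y]

/-- The element `x + ħ y` of `X[ħ]`. -/
def eps (x y : X) : DualNumber X := TrivSqZeroExt.inl x + TrivSqZeroExt.inr y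

@[simp] theorem fst_eps (x y : X) : (eps x y).fst = x := by simp [eps]

@[simp] theorem snd_eps (x y : X) : (eps x y).snd = y := by simp [eps]

/-- The `k[ħ]`-linear map `x₀ + ħ x₁ ↦ P₀(x₀) + ħ (P₀(x₁) + P₁(x₀))` given by `P₀ + ħ P₁`. -/
def act (P : DualNumber (X →ₗ[k] Y)) : DualNumber X →ₗ[k] DualNumber Y where
  toFun x := eps (P.fst x.fst) (P.fst x.snd + P.snd x.fst)
  map_add' x y := by
    ext
    · simp
    · simp; abel
  map_smul' c x := by ext <;> simp

/-- The `k[ħ]`-linear extension of a linear map. -/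
def epsMap (f : X →ₗ[k] Y) : DualNumber X →ₗ[k] DualNumber Y := act (eps f 0)

/-- The subspace `C[ħ]` of `X[ħ]`. -/
def epsSubmodule (C : Submodule k X) : Submodule k (DualNumber X) where
  carrier := {x | x.fst ∈ C ∧ x.snd ∈ C}
  add_mem' hx hy := ⟨by simpa using add_mem hx.1 hy.1, by simpa using add_mem hx.2 hy.2⟩
  zero_mem' := ⟨by simp, by simp⟩
  smul_mem' c x hx :=
    ⟨by simpa using C.smul_mem c hx.1, by simpa using C.smul_mem c hx.2⟩

variable (C : ℤ → Submodule k X) (d : ℤ → X →ₗ[k] X)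

/-- The degree `n` cocycles of the cochain complex with terms `Cⁿ ⊆ X` whose `n`-th differential is
the restriction of `dₙ` to `Cⁿ`. -/
def cocycles (n : ℤ) : Submodule k X := C n ⊓ LinearMap.ker (d n)

/-- The degree `n` coboundaries. -/
def coboundaries (n : ℤ) : Submodule k X := (C (n - 1)).map (d (n - 1))

/-- The cohomology in degree `n`. -/
abbrev Cohomology (n : ℤ) : Type _ :=
  cocycles C d n ⧸ (coboundaries C d n).submoduleOf (cocycles C d n)

/-- The cochain complex `C[ħ]`, with its differential extended `ħ`-linearly: its terms. -/
def epsC (n : ℤ) : Submodule k (DualNumber X) := epsSubmodule (C n)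

/-- The cochain complex `C[ħ]`, with its differential extended `ħ`-linearly: its differential. -/
def epsD (n : ℤ) : DualNumber X →ₗ[k] DualNumber X := epsMap (d n)

theorem mem_cocycles_eps {n : ℤ} {x : DualNumber X} :
    x ∈ cocycles (epsC C) (epsD d) n ↔ x.fst ∈ cocycles C d n ∧ x.snd ∈ cocycles C d n := by
  simp only [cocycles, epsC, epsD, epsSubmodule, epsMap, act, Submodule.mem_inf,
    LinearMap.mem_ker, TrivSqZeroExt.ext_iff]
  simp
  tauto

theorem mem_coboundaries_eps {n : ℤ} {x : DualNumber X} :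
    x ∈ coboundaries (epsC C) (epsD d) n ↔
      x.fst ∈ coboundaries C d n ∧ x.snd ∈ coboundaries C d n := by
  constructor
  · rintro ⟨y, ⟨h1, h2⟩, rfl⟩
    exact ⟨⟨y.fst, h1, by simp [epsD, epsMap, act]⟩, ⟨y.snd, h2, by simp [epsD, epsMap, act]⟩⟩
  · rintro ⟨⟨y, hy, h1⟩, ⟨z, hz, h2⟩⟩
    refine ⟨eps y z, ⟨by simpa using hy, by simpa using hz⟩, ?_⟩
    ext
    · simpa [epsD, epsMap, act] using h1
    · simpa [epsD, epsMap, act] using h2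

/-- The map `z₀ + ħ z₁ ↦ [z₀] + ħ [z₁]` on the cocycles of `C[ħ]`. -/
def classEps (n : ℤ) : cocycles (epsC C) (epsD d) n →ₗ[k] DualNumber (Cohomology C d n) where
  toFun z := eps
    (Submodule.Quotient.mk ⟨z.1.fst, ((mem_cocycles_eps C d).1 z.2).1⟩)
    (Submodule.Quotient.mk ⟨z.1.snd, ((mem_cocycles_eps C d).1 z.2).2⟩)
  map_add' x y := by ext <;> simp [← Submodule.Quotient.mk_add]
  map_smul' c x := by ext <;> simp [← Submodule.Quotient.mk_smul]

theorem classEps_surjective (n : ℤ) : Function.Surjective (classEps C d n) := by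
  intro c
  obtain ⟨x, hx⟩ := Submodule.Quotient.mk_surjective _ c.fst
  obtain ⟨y, hy⟩ := Submodule.Quotient.mk_surjective _ c.snd
  refine ⟨⟨eps x.1 y.1, (mem_cocycles_eps C d).2 ⟨by simp, by simp⟩⟩, ?_⟩
  ext
  · simpa [classEps] using hx
  · simpa [classEps] using hy

theorem ker_classEps (n : ℤ) : LinearMap.ker (classEps C d n) =
    (coboundaries (epsC C) (epsD d) n).submoduleOf (cocycles (epsC C) (epsD d) n) := by
  ext x
  rw [LinearMap.mem_ker, TrivSqZeroExt.ext_iff]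
  simp only [classEps, LinearMap.coe_mk, AddHom.coe_mk, fst_eps, snd_eps, TrivSqZeroExt.fst_zero,
    TrivSqZeroExt.snd_zero, Submodule.Quotient.mk_eq_zero]
  exact (mem_coboundaries_eps C d).symm

/-- The canonical isomorphism `Hⁿ(C[ħ]) ≅ Hⁿ(C)[ħ]`, `[z₀ + ħ z₁] ↦ [z₀] + ħ [z₁]`. -/
noncomputable def cohomologyEps (n : ℤ) :
    Cohomology (epsC C) (epsD d) n ≃ₗ[k] DualNumber (Cohomology C d n) :=
  (Submodule.quotEquivOfEq _ _ (ker_classEps C d n).symm).trans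
    ((classEps C d n).quotKerEquivOfSurjective (classEps_surjective C d n))

end Eps

/-! ### SH Lie pairs and their modules -/

section Pairs

variable {k L E : Type*} [Field k] [AddCommGroup L] [Module k L] [AddCommGroup E] [Module k E]

/-- The grading of a graded subspace. -/
def subGrading (𝓛 : ℤ → Submodule k L) (A : Submodule k L) (n : ℤ) : Submodule k A :=
  (𝓛 n).comap A.subtype

/-- The grading of the quotient by a graded subspace. -/
def quotientGrading (𝓛 : ℤ → Submodule k L) (A : Submodule k L) (n : ℤ) : Submodule k (L ⧸ A) :=
  (𝓛 n).map A.mkQ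

/-- The restriction `j^∨ : O(L) → O(A)` to a graded subspace. -/
noncomputable def restrictO (𝓛 : ℤ → Submodule k L) (A : Submodule k L) :
    O 𝓛 →ₐ[k] O (subGrading 𝓛 A) :=
  O.pullback A.subtype fun _ _ hv => hv

/-- The map `O(L / A) → O(L)` induced by the projection `L → L / A`. -/
noncomputable def inflateO (𝓛 : ℤ → Submodule k L) (A : Submodule k L) :
    O (quotientGrading 𝓛 A) →ₐ[k] O 𝓛 :=
  O.pullback A.mkQ fun _ _ hv => Submodule.mem_map_of_mem hv

/-- SH Lie pairs `(L, A)`: a homological vector field `Q_L` on the graded vector space `L` and a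
graded subspace `A` such that `Q_L` restricts to a homological vector field `Q_A` on `A`. -/
structure SHLiePair (𝓛 : ℤ → Submodule k L) [DirectSum.Decomposition 𝓛] where
  /-- the homological vector field of `L` -/
  Q : O 𝓛 →ₗ[k] O 𝓛
  isHomological : IsHomologicalVectorField 𝓛 Q
  /-- the subalgebra -/
  A : Submodule k L
  isGraded : ∀ v ∈ A, ∀ n, (DirectSum.decompose 𝓛 v n : L) ∈ A
  /-- the homological vector field of `A` -/
  QA : O (subGrading 𝓛 A) →ₗ[k] O (subGrading 𝓛 A)
  isHomologicalA : IsHomologicalVectorField (subGrading 𝓛 A) QA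
  restrict_Q : (restrictO 𝓛 A).toLinearMap ∘ₗ Q = QA ∘ₗ (restrictO 𝓛 A).toLinearMap

namespace SHLiePair

variable {𝓛 : ℤ → Submodule k L} [DirectSum.Decomposition 𝓛] (P : SHLiePair 𝓛)

/-- The algebra `O(A)`. -/
abbrev OA : Type _ := O (subGrading 𝓛 P.A)

/-- The degree `d` part of `O(A)`. -/
noncomputable abbrev degA (d : ℤ) : Submodule k P.OA := CSym.deg (dualGrading (subGrading 𝓛 P.A)) d

/-- The restriction `j^∨ : O(L) → O(A)`. -/
noncomputable def j : O 𝓛 →ₗ[k] P.OA := (restrictO 𝓛 P.A).toLinearMap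

theorem parity_mem_A (v : L) (hv : v ∈ P.A) : parity 𝓛 v ∈ P.A := by
  classical
  rw [← DirectSum.sum_support_decompose 𝓛 v, map_sum]
  refine Submodule.sum_mem _ fun n _ => ?_
  rw [parity_apply_of_mem 𝓛 (DirectSum.decompose 𝓛 v n).2]
  exact Submodule.smul_mem _ _ (P.isGraded v hv n)

/-- The parity involution of `O(L)`. -/
noncomputable def parL : O 𝓛 →ₗ[k] O 𝓛 := (O.pullback (parity 𝓛) (parity_mem 𝓛)).toLinearMap

/-- The parity involution of `O(A)`. -/
noncomputable def parA : P.OA →ₗ[k] P.OA :=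
  (O.pullback ((parity 𝓛).restrict P.parity_mem_A) fun n v hv => parity_mem 𝓛 n v hv).toLinearMap

/-- `A`-modules: a graded vector space `E` with a flat connection `∂_A^E = Q_A + D^E` on
`O(A) ⊗ E`, for an element `D^E` of degree `1` of `O(A) ⊗ End(E)`. -/
structure AModule (𝓔 : ℤ → Submodule k E) where
  /-- the connection form -/
  D : E →ₗ[k] P.OA ⊗[k] E
  degree : D ∈ endTensor P.degA 𝓔 1
  flat : connection P.parA P.QA D ∘ₗ connection P.parA P.QA D = 0

variable [CharZero k] [FiniteDimensional k L]

/-- The operator `J = (j^∨ ⊗ 1) ∘ I^L : O(L) → O(A) ⊗ L^∨`. -/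
noncomputable def J : O 𝓛 →ₗ[k] P.OA ⊗[k] Module.Dual k L :=
  P.j.rTensor (Module.Dual k L) ∘ₗ O.deRham 𝓛

/-- The `A`-module structure `J ∘ Q_L : L^∨ → O(A) ⊗ L^∨` on `L^∨`. On `A^⊥ = B^∨`, for `B = L / A`,
it is the structure `D^⊥` dual to the canonical `A`-module structure on `B`. -/
noncomputable def DL : Module.Dual k L →ₗ[k] P.OA ⊗[k] Module.Dual k L :=
  P.J ∘ₗ P.Q ∘ₗ O.gen 𝓛

/-- The right `O(A)`-module structure `(ω ⊗ ξ) · η = (-1)^(|ξ||η|) (ω ⊙ η) ⊗ ξ` on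
`O(A) ⊗ L^∨`. -/
noncomputable def rightMul :
    (P.OA ⊗[k] Module.Dual k L) ⊗[k] P.OA →ₗ[k] P.OA ⊗[k] Module.Dual k L :=
  (LinearMap.mul' k P.OA).rTensor (Module.Dual k L) ∘ₗ
    (TensorProduct.assoc k P.OA P.OA (Module.Dual k L)).symm.toLinearMap ∘ₗ
      (koszulSwap (parity 𝓛).dualMap P.parA).lTensor P.OA ∘ₗ
        (TensorProduct.assoc k P.OA (Module.Dual k L) P.OA).toLinearMap

variable {P} {𝓔 : ℤ → Submodule k E} (M : P.AModule 𝓔)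

namespace AModule

/-- The differential of the `A`-module `L^∨ ⊗ E`:
`u ⊗ e ↦ ∂^{L^∨}(u) ⊗ e + (-1)^|u| u ⊗_{O(A)} D^E(e)` for `u ∈ O(A) ⊗ L^∨` and `e ∈ E`. -/
noncomputable def tensorDiff : (P.OA ⊗[k] Module.Dual k L) ⊗[k] E →ₗ[k]
    (P.OA ⊗[k] Module.Dual k L) ⊗[k] E :=
  (connection P.parA P.QA P.DL).rTensor E +
    P.rightMul.rTensor E ∘ₗ
      (TensorProduct.assoc k (P.OA ⊗[k] Module.Dual k L) P.OA E).symm.toLinearMap ∘ₗ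
        TensorProduct.map (TensorProduct.map P.parA (parity 𝓛).dualMap) M.D

/-- The Chevalley-Eilenberg differential on cochains of degree `n` with values in `L^∨ ⊗ End(E)`,
`Ψ ↦ ∂^{L^∨ ⊗ E} ∘ Ψ - (-1)^n Ψ ∘ ∂^E`. Here `Ψ` is extended to `O(A) ⊗ E` by
`Ψ(ω ⊗ e) = (-1)^(n|ω|) ω · Ψ(e)`, and the result is restricted to `E`, where `∂^E = D^E`. -/
noncomputable def ceDiff (n : ℤ) : (E →ₗ[k] (P.OA ⊗[k] Module.Dual k L) ⊗[k] E) →ₗ[k]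
    (E →ₗ[k] (P.OA ⊗[k] Module.Dual k L) ⊗[k] E) where
  toFun Ψ := M.tensorDiff ∘ₗ Ψ -
    (-1 : k) ^ n • (signedExtension (if Even n then LinearMap.id else P.parA) Ψ ∘ₗ M.D)
  map_add' Ψ Φ := by
    have h : ∀ τ : P.OA →ₗ[k] P.OA,
        signedExtension τ (Ψ + Φ) = signedExtension τ Ψ + signedExtension τ Φ := fun τ =>
      TensorProduct.ext' fun ω e => by
        simp only [signedExtension_tmul, LinearMap.add_apply, smul_add]
    rw [h, LinearMap.comp_add, LinearMap.add_comp, smul_add]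
    abel
  map_smul' c Ψ := by
    have h : ∀ τ : P.OA →ₗ[k] P.OA,
        signedExtension τ (c • Ψ) = c • signedExtension τ Ψ := fun τ =>
      TensorProduct.ext' fun ω e => by
        simp only [signedExtension_tmul, LinearMap.smul_apply, smul_comm _ c]
    rw [h, LinearMap.comp_smul, LinearMap.smul_comp, RingHom.id_apply, smul_sub, smul_comm c]

/-- The grading of `O(A) ⊗ A^⊥`, as a subspace of `O(A) ⊗ L^∨`. Here `A^⊥ = B^∨` consists of the
functionals on `L` that vanish on `A`. -/
noncomputable def perpGrading (P : SHLiePair 𝓛) (d : ℤ) : Submodule k (P.OA ⊗[k] Module.Dual k L) :=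
  tensorGrading P.degA (fun n => dualGrading 𝓛 n ⊓ P.A.dualAnnihilator) d

/-- The degree `n` cochains of `A` with values in `B^∨ ⊗ End(E)`: the degree `n` part of
`O(A) ⊗ A^⊥ ⊗ End(E)`. -/
noncomputable def cochains (P : SHLiePair 𝓛) (𝓔 : ℤ → Submodule k E) (n : ℤ) :
    Submodule k (E →ₗ[k] (P.OA ⊗[k] Module.Dual k L) ⊗[k] E) :=
  endTensor (perpGrading P) 𝓔 n

/-- The Chevalley-Eilenberg cohomology `Hⁿ(A, B^∨ ⊗ End(E))`. -/
abbrev H (n : ℤ) : Type _ := Cohomology (cochains P 𝓔) M.ceDiff n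

/-- The Chevalley-Eilenberg cohomology `Hⁿ(A[ħ], B[ħ]^∨ ⊗ End(E[ħ]))`. As the structures of `A`, `B`
and `E` are extended trivially, the complex is obtained from the one of `A` by adjoining `ħ`. -/
abbrev Hħ (n : ℤ) : Type _ := Cohomology (epsC (cochains P 𝓔)) (epsD M.ceDiff) n

/-- The connection form `D(ħ) ∈ (O(L) ⊗ End(E))[ħ]`, of degree `1`, defines an `L[ħ]`-connection
on `E[ħ]` extending the `A[ħ]`-module `E[ħ]`. -/
structure IsExtension (D : DualNumber (E →ₗ[k] O 𝓛 ⊗[k] E)) : Prop where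
  degree_fst : D.fst ∈ endTensor (CSym.deg (dualGrading 𝓛)) 𝓔 1
  degree_snd : D.snd ∈ endTensor (CSym.deg (dualGrading 𝓛)) 𝓔 1
  restrict_fst : P.j.rTensor E ∘ₗ D.fst = M.D
  restrict_snd : P.j.rTensor E ∘ₗ D.snd = 0

end AModule

variable (P)

/-- The `L[ħ]`-connection `∇ = Q(ħ) + D(ħ)` on `E[ħ]`, as an operator on `(O(L) ⊗ E)[ħ]`. -/
noncomputable def hConnection (Q : DualNumber (Module.End k (O 𝓛)))
    (D : DualNumber (E →ₗ[k] O 𝓛 ⊗[k] E)) : DualNumber (Module.End k (O 𝓛 ⊗[k] E)) :=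
  eps (connection (parL (𝓛 := 𝓛)) Q.fst D.fst) (connection (parL (𝓛 := 𝓛)) Q.snd D.snd)

/-- The map `R ↦ (J ⊗ 1)(R)` sending an operator `R` on `O(L) ⊗ E` to the map
`E → O(A) ⊗ L^∨ ⊗ E`, `e ↦ (J ⊗ 1)(R(1 ⊗ e))`. -/
noncomputable def applyJ : Module.End k (O 𝓛 ⊗[k] E) →ₗ[k]
    (E →ₗ[k] (P.OA ⊗[k] Module.Dual k L) ⊗[k] E) where
  toFun R := P.J.rTensor E ∘ₗ R ∘ₗ TensorProduct.mk k (O 𝓛) E 1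
  map_add' R S := by rw [LinearMap.add_comp, LinearMap.comp_add]
  map_smul' c R := by rw [LinearMap.smul_comp, LinearMap.comp_smul, RingHom.id_apply]

/-- The Atiyah cocycle `α_∇ = (J ⊗ 1)(R^∇)`, where `R^∇ = ∇²` is the curvature of
`∇ = Q(ħ) + D(ħ)`. -/
noncomputable def atiyahCocycle (Q : DualNumber (Module.End k (O 𝓛)))
    (D : DualNumber (E →ₗ[k] O 𝓛 ⊗[k] E)) :
    DualNumber (E →ₗ[k] (P.OA ⊗[k] Module.Dual k L) ⊗[k] E) :=
  epsMap P.applyJ (hConnection Q D * hConnection Q D)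

/-- The operator `Q(ħ) = Q_L + ħ Q_+` on `O(L)[ħ]`. -/
noncomputable def deformed (Qp : O 𝓛 →ₗ[k] O 𝓛) : DualNumber (Module.End k (O 𝓛)) := eps P.Q Qp

/-- `c` is the Atiyah class of the SH Lie pair `(L[ħ], A[ħ])`, with the homological vector field
`Q_L + ħ Q_+`, with respect to the `A[ħ]`-module `E[ħ]`: there are `L[ħ]`-connections on `E[ħ]`
extending the `A[ħ]`-module structure, the elements `α_∇` of all of them are cocycles, and `c` is
the cohomology class of each `α_∇`. -/
def IsAtiyahClass {P : SHLiePair 𝓛} (M : P.AModule 𝓔) (Qp : O 𝓛 →ₗ[k] O 𝓛)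
    (c : DualNumber (M.H 2)) : Prop :=
  (∃ D, M.IsExtension D) ∧ ∀ D, M.IsExtension D →
    ∃ h : P.atiyahCocycle (P.deformed Qp) D ∈ cocycles (epsC (AModule.cochains P 𝓔))
        (epsD M.ceDiff) 2,
      cohomologyEps _ _ 2 (Submodule.Quotient.mk ⟨_, h⟩ : M.Hħ 2) = c

/-- `Q(ħ) = Q_L + ħ Q_+` is an `A`-compatible infinitesimal deformation of `Q_L`. -/
structure IsCompatibleDeformation (Qp : O 𝓛 →ₗ[k] O 𝓛) : Prop where
  derivation : IsDerivation 𝓛 1 Qp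
  square_zero : P.deformed Qp * P.deformed Qp = 0
  /-- the structure of `A` is not deformed -/
  restrict : epsMap P.j ∘ₗ act (P.deformed Qp) = epsMap P.QA ∘ₗ epsMap P.j
  /-- the `A`-module structure of `B` is not deformed -/
  module : ∀ ξ ∈ epsSubmodule P.A.dualAnnihilator,
    epsMap P.J (act (P.deformed Qp) (epsMap (O.gen 𝓛) ξ)) = epsMap P.DL ξ

/-- The operator `1 + ħ Λ` on `O(L)[ħ]`. -/
noncomputable def gauge (Λ : O 𝓛 →ₗ[k] O 𝓛) : DualNumber (Module.End k (O 𝓛)) := eps 1 Λ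

/-- `σ = 1 + ħ Λ` is a gauge equivalence of `O(L)[ħ]`: an automorphism of the graded algebra
`O(L)[ħ]` that is the identity on `O(B)[ħ]`, for `B = L / A`, and induces the identity on
`O(A)[ħ]`. -/
structure IsGaugeEquivalence (Λ : O 𝓛 →ₗ[k] O 𝓛) : Prop where
  degree : IsHomogeneousMap (CSym.deg (dualGrading 𝓛)) (CSym.deg (dualGrading 𝓛)) 0 Λ
  bijective : Function.Bijective (act (gauge Λ))
  map_one : act (gauge Λ) 1 = 1
  map_mul : ∀ x y, act (gauge Λ) (x * y) = act (gauge Λ) x * act (gauge Λ) y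
  inflate : act (gauge Λ) ∘ₗ epsMap (inflateO 𝓛 P.A).toLinearMap =
    epsMap (inflateO 𝓛 P.A).toLinearMap
  restrict : epsMap P.j ∘ₗ act (gauge Λ) = epsMap P.j

/-- The deformations `Q_L + ħ Q_+` and `Q_L + ħ Q̄_+` are gauge equivalent. -/
def GaugeEquivalent (Qp Qp' : O 𝓛 →ₗ[k] O 𝓛) : Prop :=
  ∃ Λ, P.IsGaugeEquivalence Λ ∧ gauge Λ * P.deformed Qp = P.deformed Qp' * gauge Λ

end SHLiePair

end Pairs

end SHLie

/-! Write `∇ = ∇₀ + ħ∇₁` with `∇₀ = Q_L + D₀` and `∇₁ = Q₊ + D₁`, and `R = ∇² = R₀ + ħR₁`, so that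
`R₀ = ∇₀²` and `R₁ = ∇₀∇₁ + ∇₁∇₀`. The curvature is `O(L)`-linear because `Q(ħ)² = 0`, and it
vanishes along `A` because `∇` restricts there to the flat `∂_A^E`. Three properties of `J`, which
is a derivation along `j^∨`, carry the proof.

(a) `J` sends functions vanishing on `A` into `O(A) ⊗ A^⊥` (`J_mem_perpGrading`). (b) `J`
intertwines `Q_L` with the differential on `O(A) ⊗ L^∨` (`J_derivation`), and hence `∇₀` with
`tensorDiff` on sections vanishing along `A` (`J_rTensor_connection`). (c) `J ∘ Q₊` and `J ∘ Λ` kill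
functions vanishing on `A` (`J_derivation_eq_zero`): both derivations restrict to zero on `A`, and
`J` kills their values on `A^⊥`.

Applying `J` to the Bianchi identity `∇R = R∇` gives the cocycle condition; by (c) the terms with
`∇₁` outermost drop out, so only the undeformed differential appears. Replacing `D` by `D + δ` with
`δ` zero along `A` changes the cocycle by the coboundary of `Jδ`, for the same reasons.

For a gauge equivalence `σ = 1 + ħΛ`, the operator `σ∇σ⁻¹` is a connection over the second
deformation, with curvature `σRσ⁻¹`. Its coefficient of `ħ` is `R₁ + ΛR₀ - R₀Λ`. On `1 ⊗ e` the last
term is zero since `Λ(1) = 0`, and `J` kills `ΛR₀(1 ⊗ e)` by (c). The two cocycles are thus equal,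
and independence of the connection gives the theorem.

Derivations of `O(L)` are not assumed continuous. Identities on `O(L)` are reduced to generators by
`O.eq_zero_of_gen_mul`, which needs no continuity. -/

namespace SHLie

/-! ### Coefficients and homogeneous elements of the completed symmetric algebra -/

section Coefficients

variable {k V W X : Type*} [Field k] [AddCommGroup V] [Module k V] [AddCommGroup W] [Module k W]
  [AddCommGroup X] [Module k X]

theorem GSym.algHom_ext {R : Type*} [Ring R] [Algebra k R] {𝓥 : ℤ → Submodule k V}
    {f g : GSym 𝓥 →ₐ[k] R} (h : ∀ v, f (GSym.ι 𝓥 v) = g (GSym.ι 𝓥 v)) : f = g := by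
  refine RingQuot.ringQuot_ext' k (A := TensorAlgebra k V) (s := GSymRel 𝓥) f g ?_
  refine TensorAlgebra.hom_ext (LinearMap.ext fun v => ?_)
  exact h v

theorem GSym.map_ι {𝓥 : ℤ → Submodule k V} {𝓦 : ℤ → Submodule k W} (f : V →ₗ[k] W)
    (hf : ∀ n, ∀ v ∈ 𝓥 n, f v ∈ 𝓦 n) (v : V) : GSym.map f hf (GSym.ι 𝓥 v) = GSym.ι 𝓦 (f v) := by
  rw [GSym.map, GSym.lift_ι]; rfl

theorem GSym.map_map {𝓥 : ℤ → Submodule k V} {𝓦 : ℤ → Submodule k W} {𝓧 : ℤ → Submodule k X}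
    (f : V →ₗ[k] W) (hf : ∀ n, ∀ v ∈ 𝓥 n, f v ∈ 𝓦 n) (g : W →ₗ[k] X)
    (hg : ∀ n, ∀ v ∈ 𝓦 n, g v ∈ 𝓧 n) (x : GSym 𝓥) :
    GSym.map g hg (GSym.map f hf x) =
      GSym.map (g ∘ₗ f) (fun n v hv => hg n _ (hf n v hv)) x := by
  have : (GSym.map g hg).comp (GSym.map f hf) =
      GSym.map (g ∘ₗ f) (fun n v hv => hg n _ (hf n v hv)) :=
    GSym.algHom_ext fun v => by simp [GSym.map_ι]
  exact DFunLike.congr_fun this x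

theorem GSym.map_id {𝓥 : ℤ → Submodule k V} (x : GSym 𝓥) :
    GSym.map (𝓥 := 𝓥) (𝓦 := 𝓥) LinearMap.id (fun _ _ hv => hv) x = x := by
  have : GSym.map (𝓥 := 𝓥) (𝓦 := 𝓥) LinearMap.id (fun _ _ hv => hv) = AlgHom.id k _ :=
    GSym.algHom_ext fun v => by simp [GSym.map_ι]
  exact DFunLike.congr_fun this x

namespace CSym

/-- The component of symmetric power `n` of a formal sum. -/
noncomputable def coeff (𝓥 : ℤ → Submodule k V) (n : ℕ) : CSym 𝓥 →ₗ[k] GSym 𝓥 where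
  toFun x := PowerSeries.coeff n (val 𝓥 x)
  map_add' x y := by simp
  map_smul' c x := by rw [map_smul]; rfl

variable {𝓥 : ℤ → Submodule k V} {𝓦 : ℤ → Submodule k W} {𝓧 : ℤ → Submodule k X}

theorem ext_coeff {x y : CSym 𝓥} (h : ∀ n, coeff 𝓥 n x = coeff 𝓥 n y) : x = y :=
  val_injective 𝓥 (PowerSeries.ext h)

theorem mem_deg {d : ℤ} {x : CSym 𝓥} : x ∈ deg 𝓥 d ↔ ∀ n, coeff 𝓥 n x ∈ GSym.piece 𝓥 n d :=
  Iff.rfl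

theorem coeff_mul (n : ℕ) (x y : CSym 𝓥) :
    coeff 𝓥 n (x * y) = ∑ p ∈ Finset.HasAntidiagonal.antidiagonal n, coeff 𝓥 p.1 x * coeff 𝓥 p.2 y := by
  change PowerSeries.coeff n (val 𝓥 (x * y)) = _
  rw [map_mul, PowerSeries.coeff_mul]
  rfl

theorem coeff_one (n : ℕ) : coeff 𝓥 n 1 = if n = 0 then 1 else 0 := by
  change PowerSeries.coeff n (val 𝓥 1) = _
  rw [map_one, PowerSeries.coeff_one]

theorem coeff_map (f : V →ₗ[k] W) (hf : ∀ n, ∀ v ∈ 𝓥 n, f v ∈ 𝓦 n) (n : ℕ) (x : CSym 𝓥) :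
    coeff 𝓦 n (map f hf x) = GSym.map f hf (coeff 𝓥 n x) := by
  change PowerSeries.coeff n (PowerSeries.mapAlgHom (GSym.map f hf) (val 𝓥 x)) = _
  rw [PowerSeries.mapAlgHom_apply]
  exact PowerSeries.coeff_map _ _ _

theorem map_map (f : V →ₗ[k] W) (hf : ∀ n, ∀ v ∈ 𝓥 n, f v ∈ 𝓦 n) (g : W →ₗ[k] X)
    (hg : ∀ n, ∀ v ∈ 𝓦 n, g v ∈ 𝓧 n) (x : CSym 𝓥) :
    map g hg (map f hf x) = map (g ∘ₗ f) (fun n v hv => hg n _ (hf n v hv)) x :=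
  ext_coeff fun n => by simp only [coeff_map, GSym.map_map]

theorem map_eq_self (f : V →ₗ[k] V) (hf : ∀ n, ∀ v ∈ 𝓥 n, f v ∈ 𝓥 n) (h : f = LinearMap.id)
    (x : CSym 𝓥) : map f hf x = x := by
  subst h
  exact ext_coeff fun n => by rw [coeff_map, GSym.map_id]

theorem map_mem_deg (f : V →ₗ[k] W) (hf : ∀ n, ∀ v ∈ 𝓥 n, f v ∈ 𝓦 n) {d : ℤ} {x : CSym 𝓥}
    (hx : x ∈ deg 𝓥 d) : map f hf x ∈ deg 𝓦 d := fun n => by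
  have := coeff_map f hf n x
  change coeff 𝓦 n (map f hf x) ∈ _
  rw [this]
  exact GSym.map_mem_piece f hf (hx n)

theorem mul_mem_deg {c d : ℤ} {x y : CSym 𝓥} (hx : x ∈ deg 𝓥 c) (hy : y ∈ deg 𝓥 d) :
    x * y ∈ deg 𝓥 (c + d) := mem_deg.2 fun n => by
  rw [coeff_mul]
  refine Submodule.sum_mem _ fun p hp => ?_
  rw [← Finset.HasAntidiagonal.mem_antidiagonal.1 hp]
  exact GSym.mul_mem_piece (hx _) (hy _)

/-- A formal sum with prescribed terms of a fixed degree. -/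
theorem exists_coeff_eq {d : ℤ} (f : ℕ → GSym 𝓥) (hf : ∀ n, f n ∈ GSym.piece 𝓥 n d) :
    ∃ x ∈ deg 𝓥 d, ∀ n, coeff 𝓥 n x = f n := by
  have h : PowerSeries.mk f ∈ homogeneousSeries 𝓥 d := fun n => by simpa using hf n
  refine ⟨⟨PowerSeries.mk f, mem_of_mem_homogeneousSeries h⟩, h, fun n => ?_⟩
  exact PowerSeries.coeff_mk n f

/-- Elements of `Ŝ(V)` are by construction finite sums of homogeneous series, so no limit enters.
Zero is homogeneous and needs no separate case. -/
theorem hom_induction {p : CSym 𝓥 → Prop} (x : CSym 𝓥) (hom : ∀ d, ∀ x ∈ deg 𝓥 d, p x)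
    (add : ∀ x y, p x → p y → p (x + y)) : p x := by
  obtain ⟨x, hx⟩ := x
  have hx' : x ∈ ⨆ d, homogeneousSeries 𝓥 d := hx
  induction hx' using Submodule.iSup_induction' with
  | mem d x h => exact hom d _ h
  | zero => exact hom 0 _ (zero_mem (deg 𝓥 0))
  | add x y hx₁ hy₁ h1 h2 => exact add ⟨x, hx₁⟩ ⟨y, hy₁⟩ (h1 hx₁) (h2 hy₁)

/-- Linear maps on `Ŝ(V)` are determined by their values on homogeneous elements. -/
theorem linearMap_ext {Y : Type*} [AddCommMonoid Y] [Module k Y] {f g : CSym 𝓥 →ₗ[k] Y}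
    (h : ∀ d, ∀ x ∈ deg 𝓥 d, f x = g x) : f = g :=
  LinearMap.ext fun x => hom_induction (p := fun x => f x = g x) x h fun x y hx hy => by
    rw [map_add, map_add, hx, hy]

theorem piece_zero_le {d : ℤ} : GSym.piece 𝓥 0 d ≤ Submodule.span k {(1 : GSym 𝓥)} := by
  refine Submodule.span_le.2 ?_
  rintro _ ⟨l, hl, -, -, rfl⟩
  obtain rfl := List.length_eq_zero_iff.1 hl
  exact Submodule.subset_span rfl

end CSym

end Coefficients

/-! ### Homogeneous bases -/

section HomogeneousBasis

variable {k L : Type*} [Field k] [AddCommGroup L] [Module k L] [FiniteDimensional k L]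
  (𝓛 : ℤ → Submodule k L) [DirectSum.Decomposition 𝓛]

/-- Homogeneous vectors span `L`, so a basis can be extracted from them. The sign rules for
contractions hold for homogeneous vectors, whereas `O.deRham` is written in an arbitrary basis;
`J_apply` makes the change. -/
theorem exists_homogeneous_basis :
    ∃ (b : Module.Basis (Fin (Module.finrank k L)) k L) (n : Fin (Module.finrank k L) → ℤ),
      ∀ i, b i ∈ 𝓛 (n i) := by
  have hs : ⊤ ≤ Submodule.span k (⋃ n, (𝓛 n : Set L)) := by
    rw [← Submodule.iSup_eq_span]
    exact (DirectSum.Decomposition.isInternal 𝓛).submodule_iSup_eq_top.ge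
  let b := Module.Basis.ofSpan hs
  have hb : ∀ i, ∃ n, b i ∈ 𝓛 n := fun i => by
    have := Module.Basis.ofSpan_subset hs ⟨i, rfl⟩
    rwa [Set.mem_iUnion] at this
  have : Fintype _ := FiniteDimensional.fintypeBasisIndex b
  let e := Fintype.equivFinOfCardEq (Module.finrank_eq_card_basis b).symm
  choose n hn using hb
  exact ⟨b.reindex e, fun i => n (e.symm i), fun i => by simpa using hn _⟩

/-- A basis of `L` that consists of homogeneous vectors. -/
noncomputable def homBasis : Module.Basis (Fin (Module.finrank k L)) k L :=
  (exists_homogeneous_basis 𝓛).choose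

/-- The degrees of the vectors of the homogeneous basis. -/
noncomputable def homDeg : Fin (Module.finrank k L) → ℤ :=
  (exists_homogeneous_basis 𝓛).choose_spec.choose

theorem homBasis_mem (i) : homBasis 𝓛 i ∈ 𝓛 (homDeg 𝓛 i) :=
  (exists_homogeneous_basis 𝓛).choose_spec.choose_spec i

theorem coord_mem (i) : (homBasis 𝓛).coord i ∈ dualGrading 𝓛 (-homDeg 𝓛 i) := by
  classical
  intro m hm v hv
  -- The projection onto `𝓛 m` fixes or kills each basis vector, so the claim on all of `𝓛 m` can be
  -- tested on the basis.
  have key : (homBasis 𝓛).coord i ∘ₗ (𝓛 m).subtype ∘ₗ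
      DirectSum.component k ℤ (fun i => 𝓛 i) m ∘ₗ
      (DirectSum.decomposeLinearEquiv 𝓛).toLinearMap = 0 := by
    refine (homBasis 𝓛).ext fun j => ?_
    change (homBasis 𝓛).coord i (DirectSum.decompose 𝓛 (homBasis 𝓛 j) m : L) = 0
    by_cases hj : homDeg 𝓛 j = m
    · subst hj
      rw [DirectSum.decompose_of_mem_same 𝓛 (homBasis_mem 𝓛 j), Module.Basis.coord_apply,
        Module.Basis.repr_self, Finsupp.single_apply, if_neg]
      rintro rfl
      exact hm (neg_neg _).symm
    · rw [DirectSum.decompose_of_mem_ne 𝓛 (homBasis_mem 𝓛 j) hj, map_zero]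
  have h := LinearMap.congr_fun key v
  change (homBasis 𝓛).coord i (DirectSum.decompose 𝓛 v m : L) = 0 at h
  rwa [DirectSum.decompose_of_mem_same 𝓛 hv] at h

end HomogeneousBasis

/-! ### Linear maps on `O(L)` controlled by generators -/

section Principle

variable {k L : Type*} [Field k] [AddCommGroup L] [Module k L] [FiniteDimensional k L]
  {𝓛 : ℤ → Submodule k L} [DirectSum.Decomposition 𝓛]

namespace O

theorem coeff_gen (ξ : Module.Dual k L) (n : ℕ) :
    CSym.coeff (dualGrading 𝓛) n (gen 𝓛 ξ) = if n = 1 then GSym.ι (dualGrading 𝓛) ξ else 0 :=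
  PowerSeries.coeff_monomial n 1 _

theorem coeff_zero_gen_mul (ξ : Module.Dual k L) (x : O 𝓛) :
    CSym.coeff (dualGrading 𝓛) 0 (gen 𝓛 ξ * x) = 0 := by
  simp [CSym.coeff_mul, coeff_gen]

theorem coeff_succ_gen_mul (ξ : Module.Dual k L) (n : ℕ) (x : O 𝓛) :
    CSym.coeff (dualGrading 𝓛) (n + 1) (gen 𝓛 ξ * x) =
      GSym.ι (dualGrading 𝓛) ξ * CSym.coeff (dualGrading 𝓛) n x := by
  rw [CSym.coeff_mul, Finset.sum_eq_single (1, n)]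
  · simp [coeff_gen]
  · rintro ⟨a, b⟩ hab hne
    have : a ≠ 1 := by
      rintro rfl
      rw [Finset.HasAntidiagonal.mem_antidiagonal] at hab
      exact hne (by rw [Prod.mk.injEq]; exact ⟨rfl, by simp at hab; omega⟩)
    simp [coeff_gen, this]
  · intro h
    exact absurd (Finset.HasAntidiagonal.mem_antidiagonal.2 (add_comm 1 n)) h

theorem gen_mem_deg {n : ℤ} {ξ : Module.Dual k L} (hξ : ξ ∈ dualGrading 𝓛 n) :
    gen 𝓛 ξ ∈ CSym.deg (dualGrading 𝓛) n := CSym.mem_deg.2 fun m => by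
  rw [coeff_gen]
  split_ifs with h
  · rw [h]; exact GSym.ι_mem_piece hξ
  · exact zero_mem _

/-- Expand the first factor `ξ` of a product in the dual basis. The coefficient `ξ(bᵢ)` vanishes
unless `bᵢ` has degree opposite to `ξ`, which is why `tᵢ` lies in degree `d + homDeg i`. -/
theorem exists_piece_succ_eq {n : ℕ} {d : ℤ} {s : GSym (dualGrading 𝓛)}
    (hs : s ∈ GSym.piece (dualGrading 𝓛) (n + 1) d) :
    ∃ t : Fin (Module.finrank k L) → GSym (dualGrading 𝓛),
      (∀ i, t i ∈ GSym.piece (dualGrading 𝓛) n (d + homDeg 𝓛 i)) ∧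
      s = ∑ i, GSym.ι (dualGrading 𝓛) ((homBasis 𝓛).coord i) * t i := by
  induction hs using Submodule.span_induction with
  | mem s hs =>
    obtain ⟨l, hl, hp, rfl, rfl⟩ := hs
    rcases l with _ | ⟨p, l⟩
    · simp at hl
    have hp1 := hp p (by simp)
    refine ⟨fun i => p.1 (homBasis 𝓛 i) • (l.map fun p => GSym.ι (dualGrading 𝓛) p.1).prod,
      fun i => ?_, ?_⟩
    · by_cases h0 : homDeg 𝓛 i = -p.2
      · exact Submodule.smul_mem _ _ (Submodule.subset_span
          ⟨l, by simpa using hl, fun q hq => hp q (by simp [hq]), by simp [h0], rfl⟩)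
      · simp only [hp1 _ h0 _ (homBasis_mem 𝓛 i), zero_smul]
        exact zero_mem _
    · have : p.1 = ∑ i, p.1 (homBasis 𝓛 i) • (homBasis 𝓛).coord i :=
        ((homBasis 𝓛).sum_dual_apply_smul_coord p.1).symm
      rw [List.map_cons, List.prod_cons]
      conv_lhs => rw [this]
      simp only [map_sum, map_smul, Finset.sum_mul, smul_mul_assoc, mul_smul_comm]
  | zero => exact ⟨0, by simp, by simp⟩
  | add x y _ _ hx hy =>
    obtain ⟨t, ht, rfl⟩ := hx
    obtain ⟨u, hu, rfl⟩ := hy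
    exact ⟨t + u, fun i => add_mem (ht i) (hu i), by simp [mul_add, Finset.sum_add_distrib]⟩
  | smul c x _ hx =>
    obtain ⟨t, ht, rfl⟩ := hx
    exact ⟨c • t, fun i => Submodule.smul_mem _ c (ht i), by simp [Finset.smul_sum]⟩

/-- Every homogeneous formal power series is the sum of a constant and of multiples of coordinate
functions. -/
theorem exists_eq_const_add {d : ℤ} {x : O 𝓛} (hx : x ∈ CSym.deg (dualGrading 𝓛) d) :
    ∃ (c : k) (g : Fin (Module.finrank k L) → O 𝓛),
      (∀ i, g i ∈ CSym.deg (dualGrading 𝓛) (d + homDeg 𝓛 i)) ∧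
      x = c • 1 + ∑ i, gen 𝓛 ((homBasis 𝓛).coord i) * g i := by
  obtain ⟨c, hc⟩ := Submodule.mem_span_singleton.1 (CSym.piece_zero_le (hx 0))
  -- The term of power `n + 1` supplies the terms of power `n` of the cofactors. For fixed `i` these
  -- all have the same degree, so they assemble into one series `g i`.
  choose t ht hxt using fun n => exists_piece_succ_eq (hx (n + 1))
  choose g hg hgt using fun i => CSym.exists_coeff_eq (𝓥 := dualGrading 𝓛) (fun n => t n i)
    (fun n => ht n i)
  refine ⟨c, g, hg, CSym.ext_coeff fun n => ?_⟩
  rcases n with _ | n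
  · simp only [map_add, map_smul, map_sum, coeff_zero_gen_mul, CSym.coeff_one, if_true,
      Finset.sum_const_zero, add_zero]
    exact hc.symm
  · simp only [map_add, map_smul, map_sum, coeff_succ_gen_mul, CSym.coeff_one, hgt]
    simp only [Nat.add_eq_zero_iff, one_ne_zero, and_false, if_false, smul_zero, zero_add]
    exact hxt n

/-- A linear map that kills `1` and is compatible with the multiplication by elements of `L^∨`
vanishes. -/
theorem eq_zero_of_gen_mul (F : O 𝓛 →ₗ[k] O 𝓛) (h1 : F 1 = 0)
    (h : ∀ n, ∀ ξ ∈ dualGrading 𝓛 n, ∀ d, ∀ g ∈ CSym.deg (dualGrading 𝓛) d,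
      ∃ η g', F (gen 𝓛 ξ * g) = gen 𝓛 η * F g') : F = 0 := by
  -- Induction on `n` for all arguments at once: a generator raises the symmetric power by one, so
  -- the coefficient `n + 1` of `η · F g'` only involves the coefficient `n` of `F g'`. The
  -- splitting of `x` into a constant and multiples of generators is exact and finite, so `F` need
  -- not be continuous.
  have key : ∀ n x, CSym.coeff (dualGrading 𝓛) n (F x) = 0 := by
    intro n
    induction n with
    | zero =>
      intro x
      induction x using CSym.hom_induction with
      | hom d x hx =>
        obtain ⟨c, g, hg, rfl⟩ := exists_eq_const_add hx
        rw [map_add, map_smul, h1, smul_zero, zero_add, map_sum, map_sum]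
        refine Finset.sum_eq_zero fun i _ => ?_
        obtain ⟨η, g', he⟩ := h _ _ (coord_mem 𝓛 i) _ _ (hg i)
        rw [he, coeff_zero_gen_mul]
      | add x y hx hy => rw [map_add, map_add, hx, hy, add_zero]
    | succ n ih =>
      intro x
      induction x using CSym.hom_induction with
      | hom d x hx =>
        obtain ⟨c, g, hg, rfl⟩ := exists_eq_const_add hx
        rw [map_add, map_smul, h1, smul_zero, zero_add, map_sum, map_sum]
        refine Finset.sum_eq_zero fun i _ => ?_
        obtain ⟨η, g', he⟩ := h _ _ (coord_mem 𝓛 i) _ _ (hg i)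
        rw [he, coeff_succ_gen_mul, ih, mul_zero]
      | add x y hx hy => rw [map_add, map_add, hx, hy, add_zero]
  exact LinearMap.ext fun x => CSym.ext_coeff fun n => by simpa using key n x

end O

end Principle

end SHLie

namespace SHLie

theorem neg_one_zpow_congr (k : Type*) [Field k] {a b : ℤ} (h : Even a ↔ Even b) :
    (-1 : k) ^ a = (-1) ^ b := by
  by_cases ha : Even a
  · rw [ha.neg_one_zpow, (h.1 ha).neg_one_zpow]
  · rw [(Int.not_even_iff_odd.1 ha).neg_one_zpow,
      (Int.not_even_iff_odd.1 fun hb => ha (h.2 hb)).neg_one_zpow]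

/-! ### Parity involutions and their powers -/

section Parity

variable {k L : Type*} [Field k] [AddCommGroup L] [Module k L]
  (𝓛 : ℤ → Submodule k L) [DirectSum.Decomposition 𝓛]

theorem GSym.par_apply_of_mem {n : ℕ} {d : ℤ} {x : GSym (dualGrading 𝓛)}
    (hx : x ∈ piece (dualGrading 𝓛) n d) : par 𝓛 x = (-1 : k) ^ d • x := by
  induction hx using Submodule.span_induction with
  | mem x hx =>
    obtain ⟨l, -, hl, rfl, rfl⟩ := hx
    induction l with
    | nil => simp
    | cons p l ih =>
      simp only [List.map_cons, List.prod_cons, List.sum_cons, map_mul]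
      rw [ih fun q hq => hl q (by simp [hq]), par_ι 𝓛 (hl p (by simp)), smul_mul_smul_comm,
        zpow_add₀ (by simp)]
  | zero => simp
  | add x y _ _ hx hy => rw [map_add, hx, hy, smul_add]
  | smul c x _ hx => rw [map_smul, hx, smul_comm]

namespace O

/-- The parity involution of `O(L)`, as a morphism of algebras. -/
noncomputable def par : O 𝓛 →ₐ[k] O 𝓛 := pullback (parity 𝓛) (parity_mem 𝓛)

variable {𝓛} in
theorem par_apply_of_mem {d : ℤ} {x : O 𝓛} (hx : x ∈ CSym.deg (dualGrading 𝓛) d) :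
    par 𝓛 x = (-1 : k) ^ d • x := CSym.ext_coeff fun n => by
  rw [par, pullback, CSym.coeff_map, map_smul]
  exact GSym.par_apply_of_mem 𝓛 (hx n)

/-- The `n`-th power `x ↦ (-1)^(n|x|) x` of the parity involution of `O(L)`. -/
noncomputable def parPow (n : ℤ) : O 𝓛 →ₐ[k] O 𝓛 := if Even n then AlgHom.id k _ else par 𝓛

variable {𝓛} in
theorem parPow_apply_of_mem (n : ℤ) {d : ℤ} {x : O 𝓛} (hx : x ∈ CSym.deg (dualGrading 𝓛) d) :
    parPow 𝓛 n x = (-1 : k) ^ (n * d) • x := by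
  unfold parPow
  split_ifs with h
  · rw [(h.mul_right d).neg_one_zpow, one_smul]; rfl
  · rw [par_apply_of_mem hx]
    congr 1
    refine neg_one_zpow_congr k ?_
    simp [Int.even_mul, h]

theorem parPow_one : parPow 𝓛 1 = par 𝓛 := by simp [parPow]

theorem parPow_of_even {n : ℤ} (h : Even n) (x : O 𝓛) : parPow 𝓛 n x = x := by simp [parPow, h]

theorem parPow_congr {m n : ℤ} (h : Even m ↔ Even n) : parPow 𝓛 m = parPow 𝓛 n := by
  simp [parPow, h]

end O

end Parity

/-! ### Contractions, graded commutativity, and the chain rule for derivations -/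

section Contraction

variable {k L : Type*} [Field k] [CharZero k] [AddCommGroup L] [Module k L]
  {𝓛 : ℤ → Submodule k L} [DirectSum.Decomposition 𝓛]

namespace GSym

theorem contract_ι_mul (v : L) (ξ : Module.Dual k L) {n : ℕ} {d : ℤ} {s : GSym (dualGrading 𝓛)}
    (hs : s ∈ piece (dualGrading 𝓛) n d) :
    contract 𝓛 v (ι (dualGrading 𝓛) ξ * s) =
      ι (dualGrading 𝓛) ξ * contract 𝓛 v s + signedEval 𝓛 v ξ s := by
  induction hs using Submodule.span_induction with
  | mem s hs =>
    obtain ⟨l, -, -, -, rfl⟩ := hs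
    -- The degree label `0` is arbitrary: `contract_cons` never reads it.
    exact contract_cons 𝓛 v (ξ, 0) l
  | zero => simp
  | add x y _ _ hx hy => rw [mul_add, map_add, hx, hy, map_add, map_add, mul_add]; abel
  | smul c x _ hx => rw [mul_smul_comm, map_smul, hx, map_smul, map_smul, mul_smul_comm, smul_add]

end GSym

namespace O

theorem coeff_contract (v : L) (n : ℕ) (x : O 𝓛) :
    CSym.coeff (dualGrading 𝓛) n (contract 𝓛 v x) =
      GSym.contract 𝓛 v (CSym.coeff (dualGrading 𝓛) (n + 1) x) :=
  coeff_contractSeries 𝓛 v _ n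

theorem contract_mem_deg {m d : ℤ} {v : L} (hv : v ∈ 𝓛 m) {x : O 𝓛}
    (hx : x ∈ CSym.deg (dualGrading 𝓛) d) :
    contract 𝓛 v x ∈ CSym.deg (dualGrading 𝓛) (d + m) := CSym.mem_deg.2 fun n => by
  rw [coeff_contract]
  exact GSym.contract_mem_piece 𝓛 hv (hx _)

theorem contract_add_left (v w : L) : contract 𝓛 (v + w) = contract 𝓛 v + contract 𝓛 w :=
  CSym.linearMap_ext fun d x hx => CSym.ext_coeff fun n => by
    rw [LinearMap.add_apply, map_add, coeff_contract, coeff_contract, coeff_contract]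
    exact GSym.contract_add_left 𝓛 v w (hx _)

theorem _root_.SHLie.GSym.contract_smul_left (c : k) (v : L) {n : ℕ} {d : ℤ}
    {x : GSym (dualGrading 𝓛)} (hx : x ∈ GSym.piece (dualGrading 𝓛) n d) :
    GSym.contract 𝓛 (c • v) x = c • GSym.contract 𝓛 v x := by
  induction hx using Submodule.span_induction with
  | mem x hx =>
    obtain ⟨l, -, -, -, rfl⟩ := hx
    induction l with
    | nil => simp only [GSym.contract_nil, smul_zero]
    | cons p l ih =>
      rw [GSym.contract_cons, ih, GSym.contract_cons]
      simp [GSym.signedEval, smul_smul, smul_sub, smul_add, sub_smul]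
  | zero => simp
  | add x y _ _ hx hy => rw [map_add, hx, hy, map_add, smul_add]
  | smul a x _ hx => rw [map_smul, hx, map_smul, smul_comm]

theorem contract_smul_left (c : k) (v : L) : contract 𝓛 (c • v) = c • contract 𝓛 v :=
  CSym.linearMap_ext fun d x hx => CSym.ext_coeff fun n => by
    rw [LinearMap.smul_apply, map_smul, coeff_contract, coeff_contract]
    exact GSym.contract_smul_left c v (hx _)

variable (𝓛) in
/-- The contraction `f ⌞ v`, as a linear map in `v`. -/
noncomputable def contractₗ : L →ₗ[k] O 𝓛 →ₗ[k] O 𝓛 where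
  toFun := contract 𝓛
  map_add' := contract_add_left
  map_smul' := contract_smul_left

theorem contract_one (v : L) : contract 𝓛 v 1 = 0 := CSym.ext_coeff fun n => by
  rw [coeff_contract, CSym.coeff_one]
  simp

variable [FiniteDimensional k L]

theorem contract_gen_mul {m : ℤ} {v : L} (hv : v ∈ 𝓛 m) {n : ℤ} {ξ : Module.Dual k L}
    (hξ : ξ ∈ dualGrading 𝓛 n) (x : O 𝓛) :
    contract 𝓛 v (gen 𝓛 ξ * x) = gen 𝓛 ξ * contract 𝓛 v x + ξ v • parPow 𝓛 m x := by
  induction x using CSym.hom_induction with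
  | add x y hx hy => simp only [mul_add, map_add, hx, hy, smul_add]; abel
  | hom d x hx =>
    -- The sign may be computed from `|v|` or from `|ξ|`: unless `m = -n`, the factor `ξ(v)` is
    -- zero.
    have h1 : ξ v • parPow 𝓛 m x = ξ v • parPow 𝓛 n x := by
      by_cases h : m = -n
      · rw [h, parPow_congr 𝓛 (by simp : Even (-n) ↔ Even n)]
      · rw [hξ m h v hv, zero_smul, zero_smul]
    rw [h1]
    refine CSym.ext_coeff fun i => ?_
    have h2 : GSym.signedEval 𝓛 v ξ (CSym.coeff (dualGrading 𝓛) i x) =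
        CSym.coeff (dualGrading 𝓛) i (ξ v • parPow 𝓛 n x) := by
      rw [GSym.signedEval_apply 𝓛 v hξ, map_smul, parPow]
      split_ifs
      · rfl
      · rw [par, pullback, CSym.coeff_map]; rfl
    rw [coeff_contract, coeff_succ_gen_mul, GSym.contract_ι_mul v ξ (CSym.mem_deg.1 hx i), h2, map_add]
    congr 1
    -- Contraction lowers the symmetric power by one, so the lowest coefficient needs its own case:
    -- there the coefficient of `x` is a scalar, which contraction kills.
    rcases i with _ | i
    · obtain ⟨c, hc⟩ := Submodule.mem_span_singleton.1 (CSym.piece_zero_le (hx 0))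
      have : CSym.coeff (dualGrading 𝓛) 0 x = c • 1 := hc.symm
      rw [coeff_zero_gen_mul, this, map_smul]
      simp [GSym.contract]
    · rw [coeff_succ_gen_mul, coeff_contract]

theorem contract_gen {m : ℤ} {v : L} (hv : v ∈ 𝓛 m) {n : ℤ} {ξ : Module.Dual k L}
    (hξ : ξ ∈ dualGrading 𝓛 n) : contract 𝓛 v (gen 𝓛 ξ) = ξ v • 1 := by
  have := contract_gen_mul hv hξ 1
  rwa [mul_one, contract_one, mul_zero, zero_add, map_one] at this

omit [CharZero k] in
theorem parPow_gen (m : ℤ) {n : ℤ} {ξ : Module.Dual k L} (hξ : ξ ∈ dualGrading 𝓛 n) :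
    parPow 𝓛 m (gen 𝓛 ξ) = gen 𝓛 ((-1 : k) ^ (m * n) • ξ) := by
  rw [parPow_apply_of_mem m (gen_mem_deg hξ), map_smul]

omit [CharZero k] in
theorem gen_comm {m n : ℤ} {ξ η : Module.Dual k L} (hξ : ξ ∈ dualGrading 𝓛 m)
    (hη : η ∈ dualGrading 𝓛 n) : gen 𝓛 ξ * gen 𝓛 η = (-1 : k) ^ (m * n) • (gen 𝓛 η * gen 𝓛 ξ) :=
  CSym.ext_coeff fun i => by
    rcases i with _ | i
    · simp [coeff_zero_gen_mul]
    · rw [map_smul, coeff_succ_gen_mul, coeff_succ_gen_mul, coeff_gen, coeff_gen]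
      split_ifs
      · exact GSym.ι_mul_ι hξ hη
      · simp

omit [CharZero k] in
-- The case of one generator, where `gen_comm` carries `gen ξ` past each generator.
-- `mul_comm_graded` uses it in turn to carry an arbitrary homogeneous element past generators.
theorem gen_mul_comm {n : ℤ} {ξ : Module.Dual k L} (hξ : ξ ∈ dualGrading 𝓛 n) (x : O 𝓛) :
    gen 𝓛 ξ * x = parPow 𝓛 n x * gen 𝓛 ξ := by
  have h : LinearMap.mulLeft k (gen 𝓛 ξ) -
      LinearMap.mulRight k (gen 𝓛 ξ) ∘ₗ (parPow 𝓛 n).toLinearMap = 0 := by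
    refine eq_zero_of_gen_mul _ (by simp) fun m η hη d g hg =>
      ⟨(-1 : k) ^ (n * m) • η, g, ?_⟩
    simp only [LinearMap.sub_apply, LinearMap.mulLeft_apply, LinearMap.comp_apply,
      LinearMap.mulRight_apply, AlgHom.toLinearMap_apply, map_mul, parPow_gen n hη,
      ← mul_assoc, gen_comm hξ hη, mul_sub, map_smul, smul_mul_assoc]
  exact sub_eq_zero.1 (LinearMap.congr_fun h x)

omit [CharZero k] in
/-- Graded commutativity of `O(L)`. -/
theorem mul_comm_graded {e : ℤ} {y : O 𝓛} (hy : y ∈ CSym.deg (dualGrading 𝓛) e) (x : O 𝓛) :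
    x * y = y * parPow 𝓛 e x := by
  have h : LinearMap.mulRight k y - LinearMap.mulLeft k y ∘ₗ (parPow 𝓛 e).toLinearMap = 0 := by
    refine eq_zero_of_gen_mul _ (by simp) fun m η hη d g hg => ⟨η, g, ?_⟩
    simp only [LinearMap.sub_apply, LinearMap.mulLeft_apply, LinearMap.comp_apply,
      LinearMap.mulRight_apply, AlgHom.toLinearMap_apply, map_mul, parPow_gen e hη, mul_sub]
    rw [← mul_assoc y, ← mul_assoc (gen 𝓛 η) y, gen_mul_comm hη y, parPow_apply_of_mem m hy,
      mul_comm e m, mul_assoc, map_smul, mul_smul_comm, smul_mul_assoc, smul_mul_assoc,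
      smul_mul_assoc]
  exact sub_eq_zero.1 (LinearMap.congr_fun h x)

/-- The vector acts from the right, so it crosses `y` before it reaches `x` and the sign falls on
`y`. For fixed `y`, the difference of the two sides commutes with left multiplication by generators
in `x`. -/
theorem contract_mul {m : ℤ} {v : L} (hv : v ∈ 𝓛 m) (x y : O 𝓛) :
    contract 𝓛 v (x * y) = x * contract 𝓛 v y + contract 𝓛 v x * parPow 𝓛 m y := by
  have h : contract 𝓛 v ∘ₗ LinearMap.mulRight k y - (LinearMap.mulRight k (contract 𝓛 v y) +
      LinearMap.mulRight k (parPow 𝓛 m y) ∘ₗ contract 𝓛 v) = 0 := by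
    refine eq_zero_of_gen_mul _ (by simp [contract_one]) fun n η hη d g hg => ⟨η, g, ?_⟩
    simp only [LinearMap.sub_apply, LinearMap.add_apply, LinearMap.comp_apply,
      LinearMap.mulRight_apply, mul_assoc, contract_gen_mul hv hη, map_mul, mul_sub, mul_add,
      add_mul, smul_mul_assoc]
    abel
  exact sub_eq_zero.1 (LinearMap.congr_fun h x)

end O

omit [CharZero k] in
theorem IsDerivation.map_mul {r : ℤ} {X : O 𝓛 →ₗ[k] O 𝓛} (hX : IsDerivation 𝓛 r X) (x y : O 𝓛) :
    X (x * y) = X x * y + O.parPow 𝓛 r x * X y := by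
  induction x using CSym.hom_induction with
  | add x y hx hy => simp only [add_mul, map_add, hx, hy]; abel
  | hom d x hx => rw [hX.leibniz d x hx, O.parPow_apply_of_mem r hx, smul_mul_assoc]

omit [CharZero k] in
theorem IsDerivation.map_one {r : ℤ} {X : O 𝓛 →ₗ[k] O 𝓛} (hX : IsDerivation 𝓛 r X) :
    X 1 = 0 := by
  simpa using hX.map_mul 1 1

omit [CharZero k] in
theorem IsDerivation.map_parPow {r : ℤ} {X : O 𝓛 →ₗ[k] O 𝓛} (hX : IsDerivation 𝓛 r X) (n : ℤ)
    (x : O 𝓛) : X (O.parPow 𝓛 n x) = (-1 : k) ^ (n * r) • O.parPow 𝓛 n (X x) := by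
  induction x using CSym.hom_induction with
  | add x y hx hy => simp only [map_add, hx, hy, smul_add]
  | hom d x hx =>
    rw [O.parPow_apply_of_mem n hx, O.parPow_apply_of_mem n (hX.degree d x hx), map_smul, smul_smul,
      ← zpow_add₀ (by simp)]
    congr 1
    refine neg_one_zpow_congr k ?_
    simp [Int.even_add, Int.even_mul]
    tauto

variable [FiniteDimensional k L]

/-- The de Rham operator commutes with derivations: this is the component of `d (X f) = L_X (d f)`
along a homogeneous vector `v`. -/
theorem IsDerivation.contract_apply {r : ℤ} {X : O 𝓛 →ₗ[k] O 𝓛} (hX : IsDerivation 𝓛 r X)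
    {m : ℤ} {v : L} (hv : v ∈ 𝓛 m) (s : O 𝓛) :
    O.contract 𝓛 v (X s) = X (O.contract 𝓛 v s) +
      ∑ i, O.parPow 𝓛 r (O.contract 𝓛 (homBasis 𝓛 i) s) *
        O.contract 𝓛 v (X (O.gen 𝓛 ((homBasis 𝓛).coord i))) := by
  have h : O.contract 𝓛 v ∘ₗ X - (X ∘ₗ O.contract 𝓛 v +
      ∑ i, LinearMap.mulRight k (O.contract 𝓛 v (X (O.gen 𝓛 ((homBasis 𝓛).coord i)))) ∘ₗ
        (O.parPow 𝓛 r).toLinearMap ∘ₗ O.contract 𝓛 (homBasis 𝓛 i)) = 0 := by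
    refine O.eq_zero_of_gen_mul _ (by simp [O.contract_one, hX.map_one]) fun n ξ hξ d g hg =>
      ⟨(-1 : k) ^ (r * n) • ξ, g, ?_⟩
    -- Expand `ξ` in the dual basis and carry `g` across the factor `(X bⁱ) ⌞ v`, of degree `-homDeg
    -- i + r + m`; together with the signs `r` and `homDeg i` already on `g` this leaves the sign
    -- `m`.
    have e1 : ∑ i, ξ (homBasis 𝓛 i) • (O.parPow 𝓛 r (O.parPow 𝓛 (homDeg 𝓛 i) g) *
        O.contract 𝓛 v (X (O.gen 𝓛 ((homBasis 𝓛).coord i)))) =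
          O.contract 𝓛 v (X (O.gen 𝓛 ξ)) * O.parPow 𝓛 m g := by
      conv_rhs => rw [← (homBasis 𝓛).sum_dual_apply_smul_coord ξ]
      simp only [map_sum, map_smul, Finset.sum_mul, smul_mul_assoc]
      refine Finset.sum_congr rfl fun i _ => ?_
      have hz := O.contract_mem_deg hv (hX.degree _ _ (O.gen_mem_deg (coord_mem 𝓛 i)))
      rw [O.mul_comm_graded hz, O.parPow_apply_of_mem _ hg, map_smul, map_smul,
        O.parPow_apply_of_mem _ hg, map_smul, O.parPow_apply_of_mem _ hg,
        O.parPow_apply_of_mem _ hg, smul_smul, smul_smul, ← zpow_add₀ (by simp),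
        ← zpow_add₀ (by simp)]
      congr 3
      refine neg_one_zpow_congr k ?_
      simp [Int.even_add, Int.even_mul]
      tauto
    -- The sign for moving `X` past the parity power is `m * r`; it agrees with `r * n` when `m =
    -- -n`, the only case where `ξ(v)` can be nonzero.
    have e2 : ξ v • X (O.parPow 𝓛 m g) =
        (-1 : k) ^ (r * n) • ξ v • O.parPow 𝓛 m (X g) := by
      by_cases h : m = -n
      · rw [hX.map_parPow, smul_comm, h]
        congr 1
        refine neg_one_zpow_congr k ?_
        simp [Int.even_mul]
        tauto
      · rw [hξ m h v hv, zero_smul, zero_smul, smul_zero]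
    simp only [LinearMap.sub_apply, LinearMap.add_apply, LinearMap.comp_apply, LinearMap.sum_apply,
      LinearMap.mulRight_apply, AlgHom.toLinearMap_apply, hX.map_mul, O.contract_gen_mul hv hξ,
      O.contract_gen_mul (homBasis_mem 𝓛 _) hξ, O.contract_mul hv, map_add, map_smul, _root_.map_mul,
      O.parPow_gen r hξ, smul_mul_assoc, e2, Finset.sum_add_distrib, e1, mul_sub, mul_add,
      smul_add, Finset.mul_sum, mul_assoc]
    abel
  have := sub_eq_zero.1 (LinearMap.congr_fun h s)
  simpa using this

end Contraction

end SHLie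

namespace SHLie

/-! ### Functoriality of pull-backs -/

section Pullback

variable {k L M N : Type*} [Field k] [AddCommGroup L] [Module k L] [AddCommGroup M] [Module k M]
  [AddCommGroup N] [Module k N]
  {𝓛 : ℤ → Submodule k L} {𝓜 : ℤ → Submodule k M} {𝓝 : ℤ → Submodule k N}

theorem O.pullback_pullback (f : M →ₗ[k] L) (hf : ∀ n, ∀ v ∈ 𝓜 n, f v ∈ 𝓛 n) (g : N →ₗ[k] M)
    (hg : ∀ n, ∀ v ∈ 𝓝 n, g v ∈ 𝓜 n) (x : O 𝓛) :
    pullback g hg (pullback f hf x) =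
      pullback (f ∘ₗ g) (fun n v hv => hf n _ (hg n v hv)) x :=
  CSym.map_map _ _ _ _ x

theorem O.pullback_mem_deg (f : M →ₗ[k] L) (hf : ∀ n, ∀ v ∈ 𝓜 n, f v ∈ 𝓛 n) {d : ℤ} {x : O 𝓛}
    (hx : x ∈ CSym.deg (dualGrading 𝓛) d) : pullback f hf x ∈ CSym.deg (dualGrading 𝓜) d :=
  CSym.map_mem_deg _ _ hx

theorem O.pullback_eq_self (f : L →ₗ[k] L) (hf : ∀ n, ∀ v ∈ 𝓛 n, f v ∈ 𝓛 n)
    (h : f = LinearMap.id) (x : O 𝓛) : pullback f hf x = x := by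
  subst h
  exact CSym.map_eq_self _ _ rfl x

variable [DirectSum.Decomposition 𝓛] [FiniteDimensional k L]

theorem O.pullback_gen (f : L →ₗ[k] L) (hf : ∀ n, ∀ v ∈ 𝓛 n, f v ∈ 𝓛 n) (ξ : Module.Dual k L) :
    pullback f hf (gen 𝓛 ξ) = gen 𝓛 (f.dualMap ξ) := CSym.ext_coeff fun n => by
  rw [pullback, CSym.coeff_map, coeff_gen, coeff_gen]
  split_ifs
  · rw [GSym.map_ι]
  · rw [map_zero]

omit [FiniteDimensional k L] in
theorem O.pullback_parPow (f : L →ₗ[k] L) (hf : ∀ n, ∀ v ∈ 𝓛 n, f v ∈ 𝓛 n) (n : ℤ) (x : O 𝓛) :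
    pullback f hf (parPow 𝓛 n x) = parPow 𝓛 n (pullback f hf x) := by
  induction x using CSym.hom_induction with
  | hom d x hx =>
    rw [parPow_apply_of_mem n hx, parPow_apply_of_mem n (pullback_mem_deg f hf hx), map_smul]
  | add x y hx hy => simp only [map_add, hx, hy]

/-- This is the chain rule `(f^∨ x) ⌞ v = f^∨ (x ⌞ f v)` at a fixed vector of `f`. It is applied to
the projector of `L` onto `A`, which avoids contractions on `O(A)`. -/
theorem O.pullback_contract [CharZero k] (f : L →ₗ[k] L) (hf : ∀ n, ∀ v ∈ 𝓛 n, f v ∈ 𝓛 n) {m : ℤ}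
    {v : L} (hv : v ∈ 𝓛 m) (hfv : f v = v) (x : O 𝓛) :
    pullback f hf (contract 𝓛 v x) = contract 𝓛 v (pullback f hf x) := by
  have h : (pullback f hf).toLinearMap ∘ₗ contract 𝓛 v -
      contract 𝓛 v ∘ₗ (pullback f hf).toLinearMap = 0 := by
    refine eq_zero_of_gen_mul _ (by simp [contract_one]) fun n η hη d g hg => ⟨f.dualMap η, g, ?_⟩
    simp only [LinearMap.sub_apply, LinearMap.comp_apply, AlgHom.toLinearMap_apply,
      contract_gen_mul hv hη, map_add, map_mul, pullback_gen, map_smul, pullback_parPow,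
      contract_gen_mul hv (dualMap_mem_dualGrading f hf _ η hη), LinearMap.dualMap_apply, hfv,
      mul_sub]
    abel
  exact sub_eq_zero.1 (LinearMap.congr_fun h x)

end Pullback

/-- The tensor `∑ T(bᵢ) ⊗ bⁱ` does not depend on the basis. -/
theorem sum_tmul_coord_comp {k L X ι κ : Type*} [Field k] [AddCommGroup L] [Module k L]
    [AddCommGroup X] [Module k X] [Fintype ι] [Fintype κ] (b : Module.Basis ι k L)
    (c : Module.Basis κ k L) (T : L →ₗ[k] X) (g : L →ₗ[k] L) :
    ∑ i, T (b i) ⊗ₜ[k] (b.coord i ∘ₗ g : Module.Dual k L) =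
      ∑ j, T (g (c j)) ⊗ₜ[k] c.coord j := by
  have h1 : ∀ i, (b.coord i ∘ₗ g : Module.Dual k L) = ∑ j, b.coord i (g (c j)) • c.coord j :=
    fun i => (c.sum_dual_apply_smul_coord (b.coord i ∘ₗ g)).symm
  simp only [h1, TensorProduct.tmul_sum, ← TensorProduct.smul_tmul]
  rw [Finset.sum_comm]
  refine Finset.sum_congr rfl fun j _ => ?_
  rw [← TensorProduct.sum_tmul]
  congr 1
  conv_rhs => rw [← b.sum_repr (g (c j)), map_sum]
  simp

namespace SHLiePair

/-! ### Graded splittings of the pair and sections of the restriction -/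

section Splitting

variable {k L : Type*} [Field k] [AddCommGroup L] [Module k L]
  {𝓛 : ℤ → Submodule k L} [DirectSum.Decomposition 𝓛] (P : SHLiePair 𝓛)

/-- Split `A ∩ 𝓛 n ⊆ 𝓛 n` in each degree separately and add up. That the result is the identity on
`A` uses that `A` contains the homogeneous components of its elements. -/
theorem exists_graded_projection : ∃ p : L →ₗ[k] P.A,
    (∀ n, ∀ v ∈ 𝓛 n, p v ∈ subGrading 𝓛 P.A n) ∧ p ∘ₗ P.A.subtype = LinearMap.id := by
  classical
  have hq : ∀ n, ∃ q : 𝓛 n →ₗ[k] subGrading 𝓛 P.A n,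
      q ∘ₗ (P.A.subtype.restrict fun _ hv => hv : subGrading 𝓛 P.A n →ₗ[k] 𝓛 n) =
        LinearMap.id := fun n => by
    refine LinearMap.exists_leftInverse_of_injective _ (LinearMap.ker_eq_bot.2 fun x y h => ?_)
    exact Subtype.ext (Subtype.ext (congrArg (fun z : 𝓛 n => (z : L)) h))
  choose q hq using hq
  let p : L →ₗ[k] P.A := DirectSum.toModule k ℤ P.A
    (fun n => (subGrading 𝓛 P.A n).subtype ∘ₗ q n) ∘ₗ
      (DirectSum.decomposeLinearEquiv 𝓛).toLinearMap
  have hp : ∀ n v (hv : v ∈ 𝓛 n), p v = q n ⟨v, hv⟩ := fun n v hv => by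
    simp only [p]
    rw [LinearMap.comp_apply, LinearEquiv.coe_coe, DirectSum.decomposeLinearEquiv_apply,
      DirectSum.decompose_of_mem 𝓛 hv, ← DirectSum.lof_eq_of k, DirectSum.toModule_lof]
    rfl
  refine ⟨p, fun n v hv => by rw [hp n v hv]; exact (q n _).2, LinearMap.ext fun a => ?_⟩
  apply Subtype.ext
  change ((p a : P.A) : L) = a
  conv_lhs => rw [← DirectSum.sum_support_decompose 𝓛 (a : L)]
  conv_rhs => rw [← DirectSum.sum_support_decompose 𝓛 (a : L)]
  rw [map_sum, AddSubmonoidClass.coe_finsetSum]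
  refine Finset.sum_congr rfl fun n _ => ?_
  rw [hp n _ (DirectSum.decompose 𝓛 (a : L) n).2]
  have := LinearMap.congr_fun (hq n)
    ⟨⟨(DirectSum.decompose 𝓛 (a : L) n : L), P.isGraded a a.2 n⟩,
      (DirectSum.decompose 𝓛 (a : L) n).2⟩
  exact congrArg (fun z : subGrading 𝓛 P.A n => ((z : P.A) : L)) this

/-- A projection `L → A` of degree `0`. -/
noncomputable def proj : L →ₗ[k] P.A := P.exists_graded_projection.choose

theorem proj_mem (n : ℤ) (v : L) (hv : v ∈ 𝓛 n) : P.proj v ∈ subGrading 𝓛 P.A n :=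
  P.exists_graded_projection.choose_spec.1 n v hv

theorem proj_apply_of_mem {v : L} (hv : v ∈ P.A) : (P.proj v : L) = v :=
  congrArg Subtype.val (LinearMap.congr_fun P.exists_graded_projection.choose_spec.2 ⟨v, hv⟩)

/-- The projection of `L` onto a graded complement of `A`. -/
noncomputable def coproj : L →ₗ[k] L := LinearMap.id - P.A.subtype ∘ₗ P.proj

theorem coproj_apply (v : L) : P.coproj v = v - P.proj v := rfl

theorem coproj_mem (n : ℤ) (v : L) (hv : v ∈ 𝓛 n) : P.coproj v ∈ 𝓛 n :=
  sub_mem hv (P.proj_mem n v hv)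

theorem comp_coproj_mem (ξ : Module.Dual k L) : ξ ∘ₗ P.coproj ∈ P.A.dualAnnihilator := by
  rw [Submodule.mem_dualAnnihilator]
  intro v hv
  rw [LinearMap.comp_apply, coproj_apply, P.proj_apply_of_mem hv, sub_self, map_zero]

theorem subtype_mem (n : ℤ) (v : P.A) (hv : v ∈ subGrading 𝓛 P.A n) : P.A.subtype v ∈ 𝓛 n := hv

theorem j_apply (x : O 𝓛) : P.j x = O.pullback P.A.subtype P.subtype_mem x := rfl

theorem restrict_parity_mem (n : ℤ) (v : P.A) (hv : v ∈ subGrading 𝓛 P.A n) :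
    (parity 𝓛).restrict P.parity_mem_A v ∈ subGrading 𝓛 P.A n := parity_mem 𝓛 n v hv

theorem parA_apply (ω : P.OA) :
    P.parA ω = O.pullback ((parity 𝓛).restrict P.parity_mem_A) P.restrict_parity_mem ω := rfl

/-- A section of the restriction `O(L) → O(A)`. -/
noncomputable def lift : P.OA →ₐ[k] O 𝓛 := O.pullback P.proj P.proj_mem

theorem j_lift (ω : P.OA) : P.j (P.lift ω) = ω := by
  rw [j_apply, lift, O.pullback_pullback]
  exact O.pullback_eq_self _ _ P.exists_graded_projection.choose_spec.2 ω

theorem j_comp_lift : P.j ∘ₗ P.lift.toLinearMap = LinearMap.id := LinearMap.ext P.j_lift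

theorem lift_mem_deg {d : ℤ} {ω : P.OA} (hω : ω ∈ P.degA d) :
    P.lift ω ∈ CSym.deg (dualGrading 𝓛) d := O.pullback_mem_deg _ _ hω

theorem j_mem_degA {d : ℤ} {x : O 𝓛} (hx : x ∈ CSym.deg (dualGrading 𝓛) d) : P.j x ∈ P.degA d :=
  O.pullback_mem_deg P.A.subtype (fun _ _ hv => hv) hx

theorem j_mul (x y : O 𝓛) : P.j (x * y) = P.j x * P.j y := _root_.map_mul (restrictO 𝓛 P.A) x y

theorem j_Q (x : O 𝓛) : P.j (P.Q x) = P.QA (P.j x) := LinearMap.congr_fun P.restrict_Q x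

/-- The `n`-th power of the parity involution of `O(A)`. -/
noncomputable def parPowA (n : ℤ) : P.OA →ₗ[k] P.OA := if Even n then LinearMap.id else P.parA

theorem parA_j (x : O 𝓛) : P.parA (P.j x) = P.j (O.par 𝓛 x) := by
  rw [j_apply, j_apply, parA_apply, O.pullback_pullback, O.par, O.pullback_pullback]
  rfl

theorem parPowA_j (n : ℤ) (x : O 𝓛) : P.parPowA n (P.j x) = P.j (O.parPow 𝓛 n x) := by
  unfold parPowA O.parPow
  split_ifs
  · rfl
  · exact P.parA_j x

end Splitting

/-! ### The operator `J` -/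

section DeRham

variable {k L : Type*} [Field k] [CharZero k] [AddCommGroup L] [Module k L]
  [FiniteDimensional k L] {𝓛 : ℤ → Submodule k L} [DirectSum.Decomposition 𝓛] (P : SHLiePair 𝓛)

/-- Derivatives along `A` of a function vanishing on `A` vanish on `A`. The projector onto `A` fixes
`v`, so its pull-back `lift ∘ j` commutes with contraction by `v`; hence `lift (j (x ⌞ v))` is the
contraction of `lift (j x) = 0`, and `lift` is a section of `j`. -/
theorem j_contract_eq_zero {x : O 𝓛} (hx : P.j x = 0) {m : ℤ} {v : L} (hv : v ∈ 𝓛 m)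
    (hvA : v ∈ P.A) : P.j (O.contract 𝓛 v x) = 0 := by
  have h := O.pullback_contract (𝓛 := 𝓛) (P.A.subtype ∘ₗ P.proj) (fun n v hv => P.proj_mem n v hv)
    hv (P.proj_apply_of_mem hvA) x
  rw [← O.pullback_pullback P.A.subtype P.subtype_mem P.proj P.proj_mem,
    ← O.pullback_pullback P.A.subtype P.subtype_mem P.proj P.proj_mem] at h
  change P.lift (P.j _) = O.contract 𝓛 v (P.lift (P.j x)) at h
  rw [hx, map_zero, map_zero] at h
  rw [← P.j_lift (P.j (O.contract 𝓛 v x)), h, map_zero]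

theorem J_eq_sum_comp (x : O 𝓛) (g : L →ₗ[k] L) :
    ∑ i, P.j (O.contract 𝓛 (homBasis 𝓛 i) x) ⊗ₜ[k]
        ((homBasis 𝓛).coord i ∘ₗ g : Module.Dual k L) =
      ∑ i, P.j (O.contract 𝓛 (g (homBasis 𝓛 i)) x) ⊗ₜ[k] (homBasis 𝓛).coord i :=
  sum_tmul_coord_comp (homBasis 𝓛) (homBasis 𝓛) (P.j ∘ₗ (O.contractₗ 𝓛).flip x) g

theorem J_apply (x : O 𝓛) :
    P.J x = ∑ i, P.j (O.contract 𝓛 (homBasis 𝓛 i) x) ⊗ₜ[k] (homBasis 𝓛).coord i := by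
  have h := sum_tmul_coord_comp (Module.finBasis k L) (homBasis 𝓛) (P.j ∘ₗ (O.contractₗ 𝓛).flip x)
    LinearMap.id
  simp only [LinearMap.comp_id, LinearMap.id_apply] at h
  refine Eq.trans ?_ h
  simp only [J, O.deRham, LinearMap.comp_apply, LinearMap.sum_apply, map_sum]
  rfl

/-- `J` maps the functions vanishing on `A` to `O(A) ⊗ A^⊥`. -/
theorem J_mem_perpGrading {d : ℤ} {x : O 𝓛} (hx : x ∈ CSym.deg (dualGrading 𝓛) d)
    (hjx : P.j x = 0) : P.J x ∈ AModule.perpGrading P d := by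
  -- Composing the dual basis with the projection onto a complement of `A` only discards the
  -- derivatives of `x` along `A`, which restrict to zero; the composed functionals lie in `A^⊥`.
  have h : P.J x = ∑ i, P.j (O.contract 𝓛 (homBasis 𝓛 i) x) ⊗ₜ[k]
      ((homBasis 𝓛).coord i ∘ₗ P.coproj : Module.Dual k L) := by
    rw [P.J_eq_sum_comp x P.coproj, J_apply]
    refine Finset.sum_congr rfl fun i _ => ?_
    have hs : O.contract 𝓛 (P.coproj (homBasis 𝓛 i)) x =
        O.contract 𝓛 (homBasis 𝓛 i) x - O.contract 𝓛 (P.proj (homBasis 𝓛 i) : L) x :=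
      LinearMap.congr_fun (map_sub (O.contractₗ 𝓛) _ _) x
    have h0 : P.j (O.contract 𝓛 (P.proj (homBasis 𝓛 i) : L) x) = 0 :=
      P.j_contract_eq_zero hjx (P.proj_mem _ _ (homBasis_mem 𝓛 i)) (P.proj (homBasis 𝓛 i)).2
    rw [hs, map_sub, h0, sub_zero]
  rw [h]
  exact Submodule.sum_mem _ fun i _ => Submodule.subset_span
    ⟨d + homDeg 𝓛 i, -homDeg 𝓛 i, by ring, _,
      P.j_mem_degA (O.contract_mem_deg (homBasis_mem 𝓛 i) hx), _,
      ⟨dualMap_mem_dualGrading P.coproj P.coproj_mem _ _ (coord_mem 𝓛 i), P.comp_coproj_mem ((homBasis 𝓛).coord i)⟩,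
      rfl⟩

omit [FiniteDimensional k L] in
-- For odd `ξ` the Koszul swap subtracts twice the odd part of `η`, and `1 - 2 · (1 - p)/2 = p` is
-- the parity involution.
theorem rightMul_tmul (ω η : P.OA) {n : ℤ} {ξ : Module.Dual k L} (hξ : ξ ∈ dualGrading 𝓛 n) :
    P.rightMul ((ω ⊗ₜ ξ) ⊗ₜ η) = (ω * P.parPowA n η) ⊗ₜ ξ := by
  have hp : (parity 𝓛).dualMap ξ = (-1 : k) ^ n • ξ :=
    LinearMap.ext fun v => dual_parity_apply 𝓛 hξ v
  have hs : koszulSwap (parity 𝓛).dualMap P.parA (ξ ⊗ₜ η) = P.parPowA n η ⊗ₜ[k] ξ := by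
    simp only [koszulSwap, LinearMap.sub_apply, LinearMap.smul_apply, LinearMap.comp_apply,
      LinearEquiv.coe_coe, TensorProduct.comm_tmul, TensorProduct.map_tmul, oddPart,
      LinearMap.id_apply, hp, parPowA]
    split_ifs with h
    · simp [h.neg_one_zpow]
    · rw [(Int.not_even_iff_odd.1 h).neg_one_zpow]
      have : (2 : k)⁻¹ • (ξ - (-1 : k) • ξ) = ξ := by
        rw [neg_one_smul, sub_neg_eq_add, ← two_smul k ξ, smul_smul,
          inv_mul_cancel₀ two_ne_zero, one_smul]
      rw [this, TensorProduct.smul_tmul', smul_smul, mul_inv_cancel₀ two_ne_zero, one_smul,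
        ← TensorProduct.sub_tmul, sub_sub_cancel]
  simp only [rightMul, LinearMap.comp_apply, LinearEquiv.coe_coe, TensorProduct.assoc_tmul,
    LinearMap.lTensor_tmul, hs, TensorProduct.assoc_symm_tmul, LinearMap.rTensor_tmul,
    LinearMap.mul'_apply]

theorem J_mul (x y : O 𝓛) : P.J (x * y) = P.j x • P.J y + P.rightMul (P.J x ⊗ₜ P.j y) := by
  simp only [J_apply, TensorProduct.sum_tmul, map_sum, Finset.smul_sum,
    ← Finset.sum_add_distrib]
  refine Finset.sum_congr rfl fun i _ => ?_
  rw [rightMul_tmul P _ _ (coord_mem 𝓛 i), O.contract_mul (homBasis_mem 𝓛 i), map_add,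
    TensorProduct.add_tmul, j_mul, j_mul, parPowA_j, O.parPow_congr 𝓛 (even_neg (a := homDeg 𝓛 i)),
    TensorProduct.smul_tmul', smul_eq_mul]

/-- The operator `J` intertwines a derivation of `O(L)` that restricts to `Y` on `O(A)` with the
induced operator on `O(A) ⊗ L^∨`. -/
theorem J_derivation {r : ℤ} {X : O 𝓛 →ₗ[k] O 𝓛} (hX : IsDerivation 𝓛 r X) {Y : P.OA →ₗ[k] P.OA}
    (hY : P.j ∘ₗ X = Y ∘ₗ P.j) (s : O 𝓛) :
    P.J (X s) = Y.rTensor _ (P.J s) +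
      signedExtension (P.parPowA r) (P.J ∘ₗ X ∘ₗ O.gen 𝓛) (P.J s) := by
  rw [P.J_apply s]
  simp only [map_sum, LinearMap.rTensor_tmul, signedExtension_tmul]
  rw [J_apply]
  have h : ∀ i, P.j (O.contract 𝓛 (homBasis 𝓛 i) (X s)) ⊗ₜ[k] (homBasis 𝓛).coord i =
      Y (P.j (O.contract 𝓛 (homBasis 𝓛 i) s)) ⊗ₜ[k] (homBasis 𝓛).coord i +
        ∑ l, P.parPowA r (P.j (O.contract 𝓛 (homBasis 𝓛 l) s)) •
          (P.j (O.contract 𝓛 (homBasis 𝓛 i) (X (O.gen 𝓛 ((homBasis 𝓛).coord l)))) ⊗ₜ[k]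
            (homBasis 𝓛).coord i) := fun i => by
    rw [hX.contract_apply (homBasis_mem 𝓛 i), map_add, TensorProduct.add_tmul, map_sum,
      TensorProduct.sum_tmul]
    congr 1
    · exact congrArg (· ⊗ₜ[k] _) (LinearMap.congr_fun hY _)
    · refine Finset.sum_congr rfl fun l _ => ?_
      rw [j_mul, parPowA_j, TensorProduct.smul_tmul', smul_eq_mul]
  rw [Finset.sum_congr rfl fun i _ => h i, Finset.sum_add_distrib, Finset.sum_comm]
  congr 1
  refine Finset.sum_congr rfl fun l _ => ?_
  rw [← Finset.smul_sum, LinearMap.comp_apply, LinearMap.comp_apply, J_apply]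

end DeRham

end SHLiePair

end SHLie

namespace SHLie

/-! ### Connections on `O(L) ⊗ E` and linearity of curvature -/

section Connection

variable {k L E : Type*} [Field k] [AddCommGroup L] [Module k L] [AddCommGroup E] [Module k E]
  {𝓛 : ℤ → Submodule k L}

theorem connection_tmul (τ X : O 𝓛 →ₗ[k] O 𝓛) (D : E →ₗ[k] O 𝓛 ⊗[k] E) (s : O 𝓛) (e : E) :
    connection τ X D (s ⊗ₜ e) = X s ⊗ₜ e + τ s • D e := rfl

variable [DirectSum.Decomposition 𝓛]

theorem O.par_par (x : O 𝓛) : O.par 𝓛 (O.par 𝓛 x) = x := by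
  induction x using CSym.hom_induction with
  | add x y hx hy => simp only [map_add, hx, hy]
  | hom d x hx =>
    rw [O.par_apply_of_mem hx, map_smul, O.par_apply_of_mem hx, smul_smul, ← mul_zpow, neg_mul_neg,
      one_mul, one_zpow, one_smul]

theorem O.par_mem_deg {d : ℤ} {x : O 𝓛} (hx : x ∈ CSym.deg (dualGrading 𝓛) d) :
    O.par 𝓛 x ∈ CSym.deg (dualGrading 𝓛) d := O.pullback_mem_deg _ _ hx

variable {X X' : O 𝓛 →ₗ[k] O 𝓛}

theorem parL_apply (s : O 𝓛) : SHLiePair.parL (𝓛 := 𝓛) s = O.par 𝓛 s := rfl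

theorem IsDerivation.leibniz_par (hX : IsDerivation 𝓛 1 X) (x y : O 𝓛) :
    X (x * y) = X x * y + O.par 𝓛 x * X y := by
  rw [hX.map_mul, O.parPow_one]

theorem IsDerivation.map_par (hX : IsDerivation 𝓛 1 X) (x : O 𝓛) :
    X (O.par 𝓛 x) = -O.par 𝓛 (X x) := by
  simpa [O.parPow_one] using hX.map_parPow 1 x

theorem connection_one_tmul (hX : IsDerivation 𝓛 1 X) (D : E →ₗ[k] O 𝓛 ⊗[k] E) (e : E) :
    connection (SHLiePair.parL (𝓛 := 𝓛)) X D (1 ⊗ₜ e) = D e := by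
  rw [connection_tmul, hX.map_one, TensorProduct.zero_tmul, zero_add, parL_apply, _root_.map_one,
    one_smul]

theorem connection_smul (hX : IsDerivation 𝓛 1 X) (D : E →ₗ[k] O 𝓛 ⊗[k] E) (s : O 𝓛)
    (z : O 𝓛 ⊗[k] E) : connection (SHLiePair.parL (𝓛 := 𝓛)) X D (s • z) =
      X s • z + O.par 𝓛 s • connection (SHLiePair.parL (𝓛 := 𝓛)) X D z := by
  induction z using TensorProduct.induction_on with
  | zero => simp
  | add x y hx hy => simp only [smul_add, map_add, hx, hy]; abel
  | tmul t e =>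
    rw [TensorProduct.smul_tmul', smul_eq_mul, connection_tmul, connection_tmul, hX.leibniz_par,
      parL_apply, parL_apply, map_mul, mul_smul, TensorProduct.add_tmul, smul_add,
      TensorProduct.smul_tmul', TensorProduct.smul_tmul', smul_eq_mul, smul_eq_mul, add_assoc]

/-- The graded commutator of two connections is linear over `O(L)` if the vector fields commute. -/
theorem connection_comm_smul (hX : IsDerivation 𝓛 1 X) (hX' : IsDerivation 𝓛 1 X')
    (h : ∀ s, X (X' s) + X' (X s) = 0) (D D' : E →ₗ[k] O 𝓛 ⊗[k] E) (s : O 𝓛) (z : O 𝓛 ⊗[k] E) :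
    connection (SHLiePair.parL (𝓛 := 𝓛)) X D (connection (SHLiePair.parL (𝓛 := 𝓛)) X' D' (s • z)) +
      connection (SHLiePair.parL (𝓛 := 𝓛)) X' D'
        (connection (SHLiePair.parL (𝓛 := 𝓛)) X D (s • z)) =
    s • (connection (SHLiePair.parL (𝓛 := 𝓛)) X D (connection (SHLiePair.parL (𝓛 := 𝓛)) X' D' z) +
      connection (SHLiePair.parL (𝓛 := 𝓛)) X' D'
        (connection (SHLiePair.parL (𝓛 := 𝓛)) X D z)) := by
  have h' := eq_neg_of_add_eq_zero_left (h s)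
  -- The cross terms cancel in pairs because an odd derivation anticommutes with the parity
  -- involution.
  simp only [connection_smul hX, connection_smul hX', map_add, hX.map_par, hX'.map_par, h',
    O.par_par, neg_smul, smul_add]
  abel

/-- The curvature of a flat vector field is linear over `O(L)`. -/
theorem connection_sq_smul (hX : IsDerivation 𝓛 1 X) (h : ∀ s, X (X s) = 0)
    (D : E →ₗ[k] O 𝓛 ⊗[k] E) (s : O 𝓛) (z : O 𝓛 ⊗[k] E) :
    connection (SHLiePair.parL (𝓛 := 𝓛)) X D (connection (SHLiePair.parL (𝓛 := 𝓛)) X D (s • z)) =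
    s • connection (SHLiePair.parL (𝓛 := 𝓛)) X D (connection (SHLiePair.parL (𝓛 := 𝓛)) X D z) := by
  simp only [connection_smul hX, map_add, hX.map_par, h, O.par_par, neg_smul, zero_smul]
  abel

omit [DirectSum.Decomposition 𝓛] in
theorem tmul_eq_smul (s : O 𝓛) (e : E) : s ⊗ₜ[k] e = s • ((1 : O 𝓛) ⊗ₜ[k] e) := by
  rw [TensorProduct.smul_tmul', smul_eq_mul, mul_one]

variable {𝓔 : ℤ → Submodule k E}

theorem connection_comp_mem_endTensor {n : ℤ}
    (hX : IsHomogeneousMap (CSym.deg (dualGrading 𝓛)) (CSym.deg (dualGrading 𝓛)) 1 X)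
    {D Φ : E →ₗ[k] O 𝓛 ⊗[k] E} (hD : D ∈ endTensor (CSym.deg (dualGrading 𝓛)) 𝓔 1)
    (hΦ : Φ ∈ endTensor (CSym.deg (dualGrading 𝓛)) 𝓔 n) :
    connection (SHLiePair.parL (𝓛 := 𝓛)) X D ∘ₗ Φ ∈
      endTensor (CSym.deg (dualGrading 𝓛)) 𝓔 (n + 1) := by
  induction hΦ using Submodule.span_induction with
  | zero => simp
  | add x y _ _ hx hy => rw [LinearMap.comp_add]; exact add_mem hx hy
  | smul c x _ hx => rw [LinearMap.comp_smul]; exact Submodule.smul_mem _ c hx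
  | mem Φ hΦ =>
    obtain ⟨a, b, rfl, u, hu, φ, hφ, rfl⟩ := hΦ
    have e1 : connection (SHLiePair.parL (𝓛 := 𝓛)) X D ∘ₗ TensorProduct.mk k (O 𝓛) E u ∘ₗ φ =
        TensorProduct.mk k (O 𝓛) E (X u) ∘ₗ φ +
          (Algebra.lsmul k k (O 𝓛 ⊗[k] E) (O.par 𝓛 u)) ∘ₗ D ∘ₗ φ := rfl
    rw [e1]
    refine add_mem (Submodule.subset_span ⟨a + 1, b, by ring, _, hX a u hu, φ, hφ, rfl⟩) ?_
    clear e1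
    induction hD using Submodule.span_induction with
    | zero => simp
    | add x y _ _ hx hy => rw [LinearMap.add_comp, LinearMap.comp_add]; exact add_mem hx hy
    | smul c x _ hx =>
      rw [LinearMap.smul_comp, LinearMap.comp_smul]; exact Submodule.smul_mem _ c hx
    | mem D hD =>
      obtain ⟨a', b', hab, u', hu', φ', hφ', rfl⟩ := hD
      refine Submodule.subset_span ⟨a + a', b + b', by rw [← hab]; ring, _,
        CSym.mul_mem_deg (O.par_mem_deg hu) hu', φ' ∘ₗ φ, fun n v hv => ?_, ?_⟩
      · rw [← add_assoc]; exact hφ' _ _ (hφ _ _ hv)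
      · ext e
        simp [TensorProduct.smul_tmul']

theorem rTensor_comp_mem_endTensor {M N : Type*} [AddCommGroup M] [Module k M] [AddCommGroup N]
    [Module k N] {𝓤 : ℤ → Submodule k M} {𝓦 : ℤ → Submodule k N} {r : ℤ} {T : M →ₗ[k] N}
    (hT : IsHomogeneousMap 𝓤 𝓦 r T) {n : ℤ} {Φ : E →ₗ[k] M ⊗[k] E} (hΦ : Φ ∈ endTensor 𝓤 𝓔 n) :
    T.rTensor E ∘ₗ Φ ∈ endTensor 𝓦 𝓔 (n + r) := by
  induction hΦ using Submodule.span_induction with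
  | zero => simp
  | add x y _ _ hx hy => rw [LinearMap.comp_add]; exact add_mem hx hy
  | smul c x _ hx => rw [LinearMap.comp_smul]; exact Submodule.smul_mem _ c hx
  | mem Φ hΦ =>
    obtain ⟨a, b, rfl, u, hu, φ, hφ, rfl⟩ := hΦ
    exact Submodule.subset_span ⟨a + r, b, by ring, _, hT a u hu, φ, hφ, rfl⟩

end Connection

/-! ### Sections vanishing along `A`, and `J` on `O(L) ⊗ E` -/

namespace SHLiePair

variable {k L E : Type*} [Field k] [AddCommGroup L] [Module k L]
  [AddCommGroup E] [Module k E] {𝓛 : ℤ → Submodule k L}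
  [DirectSum.Decomposition 𝓛] (P : SHLiePair 𝓛)

/-- The element `s - lift (j s)` is homogeneous and vanishes on `A`. Thus an operator that kills
such functions factors through `j`, and the factorization survives tensoring with `E`, as
`rTensor_eq_zero` needs. -/
theorem eq_comp_lift_comp_j {Y : Type*} [AddCommGroup Y] [Module k Y] (T : O 𝓛 →ₗ[k] Y)
    (hT : ∀ d, ∀ s ∈ CSym.deg (dualGrading 𝓛) d, P.j s = 0 → T s = 0) :
    T = (T ∘ₗ P.lift.toLinearMap) ∘ₗ P.j :=
  CSym.linearMap_ext fun d s hs => by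
    have h := hT d (s - P.lift (P.j s)) (sub_mem hs (P.lift_mem_deg (P.j_mem_degA hs)))
      (by rw [map_sub, j_lift, sub_self])
    rw [map_sub, sub_eq_zero] at h
    exact h

theorem rTensor_eq_zero {Y : Type*} [AddCommGroup Y] [Module k Y] (T : O 𝓛 →ₗ[k] Y)
    (hT : ∀ d, ∀ s ∈ CSym.deg (dualGrading 𝓛) d, P.j s = 0 → T s = 0) {z : O 𝓛 ⊗[k] E}
    (hz : P.j.rTensor E z = 0) : T.rTensor E z = 0 := by
  rw [P.eq_comp_lift_comp_j T hT, LinearMap.rTensor_comp_apply, hz, map_zero]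

theorem j_rTensor_smul (s : O 𝓛) (z : O 𝓛 ⊗[k] E) :
    P.j.rTensor E (s • z) = P.j s • P.j.rTensor E z := by
  induction z using TensorProduct.induction_on with
  | zero => simp
  | add x y hx hy => simp only [smul_add, map_add, hx, hy]
  | tmul t e =>
    rw [TensorProduct.smul_tmul', smul_eq_mul, LinearMap.rTensor_tmul, LinearMap.rTensor_tmul,
      j_mul, TensorProduct.smul_tmul', smul_eq_mul]

theorem j_rTensor_connection {X : O 𝓛 →ₗ[k] O 𝓛} {Y : P.OA →ₗ[k] P.OA} (h : ∀ s, P.j (X s) = Y (P.j s))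
    (D : E →ₗ[k] O 𝓛 ⊗[k] E) (z : O 𝓛 ⊗[k] E) :
    P.j.rTensor E (connection (parL (𝓛 := 𝓛)) X D z) =
      connection P.parA Y (P.j.rTensor E ∘ₗ D) (P.j.rTensor E z) := by
  induction z using TensorProduct.induction_on with
  | zero => simp
  | add x y hx hy => simp only [map_add, hx, hy]
  | tmul s e =>
    rw [connection_tmul, map_add, LinearMap.rTensor_tmul, h, j_rTensor_smul, LinearMap.rTensor_tmul,
      connection_tmul, parL_apply, parA_j]
    rfl

variable [CharZero k] [FiniteDimensional k L]

/-- The right multiplication `u ⊗ (η ⊗ e) ↦ (u · η) ⊗ e`. -/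
noncomputable def rightMulTensor :
    (P.OA ⊗[k] Module.Dual k L) ⊗[k] (P.OA ⊗[k] E) →ₗ[k] (P.OA ⊗[k] Module.Dual k L) ⊗[k] E :=
  P.rightMul.rTensor E ∘ₗ
    (TensorProduct.assoc k (P.OA ⊗[k] Module.Dual k L) P.OA E).symm.toLinearMap

omit [CharZero k] [FiniteDimensional k L] in
theorem rightMulTensor_tmul (u : P.OA ⊗[k] Module.Dual k L) (η : P.OA) (e : E) :
    P.rightMulTensor (u ⊗ₜ (η ⊗ₜ e)) = P.rightMul (u ⊗ₜ η) ⊗ₜ e := rfl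

theorem J_rTensor_smul (s : O 𝓛) (z : O 𝓛 ⊗[k] E) :
    P.J.rTensor E (s • z) =
      P.j s • P.J.rTensor E z + P.rightMulTensor (P.J s ⊗ₜ P.j.rTensor E z) := by
  induction z using TensorProduct.induction_on with
  | zero => simp
  | add x y hx hy => simp only [smul_add, map_add, hx, hy, TensorProduct.tmul_add]; abel
  | tmul t e =>
    rw [TensorProduct.smul_tmul', smul_eq_mul, LinearMap.rTensor_tmul, LinearMap.rTensor_tmul,
      LinearMap.rTensor_tmul, J_mul, rightMulTensor_tmul, TensorProduct.smul_tmul',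
      TensorProduct.add_tmul]

theorem J_par (s : O 𝓛) :
    P.J (O.par 𝓛 s) = TensorProduct.map P.parA (parity 𝓛).dualMap (P.J s) := by
  induction s using CSym.hom_induction with
  | add x y hx hy => simp only [map_add, hx, hy]
  | hom d s hs =>
    rw [O.par_apply_of_mem hs, map_smul, J_apply, map_sum, Finset.smul_sum]
    refine Finset.sum_congr rfl fun i _ => ?_
    have hp : (parity 𝓛).dualMap ((homBasis 𝓛).coord i) =
        (-1 : k) ^ (-homDeg 𝓛 i) • (homBasis 𝓛).coord i :=
      LinearMap.ext fun v => dual_parity_apply 𝓛 (coord_mem 𝓛 i) v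
    rw [TensorProduct.map_tmul, parA_j,
      O.par_apply_of_mem (O.contract_mem_deg (homBasis_mem 𝓛 i) hs), hp, map_smul,
      TensorProduct.smul_tmul_smul, ← zpow_add₀ (by simp), add_neg_cancel_right]

variable {P} {𝓔 : ℤ → Submodule k E} (M : P.AModule 𝓔)

/-- Both terms of `∇₀` are differentiated: `J` turns `Q_L` into the differential on `O(A) ⊗ L^∨`,
and the product rule on `s · D e` yields the twist by `D^E` plus a term in `J D`. That last term
depends on `z` only through its restriction to `A`. -/
theorem J_rTensor_connection {D : E →ₗ[k] O 𝓛 ⊗[k] E} (hD : P.j.rTensor E ∘ₗ D = M.D)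
    (z : O 𝓛 ⊗[k] E) : P.J.rTensor E (connection (parL (𝓛 := 𝓛)) P.Q D z) =
      M.tensorDiff (P.J.rTensor E z) +
        signedExtension P.parA (P.J.rTensor E ∘ₗ D) (P.j.rTensor E z) := by
  induction z using TensorProduct.induction_on with
  | zero => simp
  | add x y hx hy => simp only [map_add, hx, hy]; abel
  | tmul s e =>
    have h1 : P.J (P.Q s) = connection P.parA P.QA P.DL (P.J s) := by
      have h := P.J_derivation P.isHomological.derivation P.restrict_Q s
      have hp : P.parPowA 1 = P.parA := by simp [parPowA]
      rw [hp] at h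
      exact h
    have h2 : M.tensorDiff (P.J s ⊗ₜ[k] e) = connection P.parA P.QA P.DL (P.J s) ⊗ₜ e +
        P.rightMulTensor (TensorProduct.map P.parA (parity 𝓛).dualMap (P.J s) ⊗ₜ M.D e) := rfl
    rw [connection_tmul, map_add, LinearMap.rTensor_tmul, LinearMap.rTensor_tmul,
      LinearMap.rTensor_tmul, J_rTensor_smul, signedExtension_tmul, h2, h1, parL_apply, J_par,
      parA_j, ← hD, LinearMap.comp_apply, LinearMap.comp_apply]
    abel

variable (P) in
/-- A derivation that restricts to zero on `A` and on `A^⊥` does not contribute to `J`. -/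
theorem J_derivation_eq_zero {r : ℤ} {X : O 𝓛 →ₗ[k] O 𝓛} (hX : IsDerivation 𝓛 r X)
    (hj : ∀ s, P.j (X s) = 0)
    (hJ : ∀ n, ∀ ξ ∈ dualGrading 𝓛 n ⊓ P.A.dualAnnihilator, P.J (X (O.gen 𝓛 ξ)) = 0)
    {d : ℤ} {s : O 𝓛} (hs : s ∈ CSym.deg (dualGrading 𝓛) d) (hjs : P.j s = 0) :
    P.J (X s) = 0 := by
  -- With `Y = 0` only the term feeding the `L^∨`-components of `J s` to `J ∘ X` survives, and those
  -- components lie in `A^⊥` because `s` vanishes on `A`.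
  have h := P.J_derivation hX (Y := 0) (LinearMap.ext fun s => by simpa using hj s) s
  rw [h]
  have hm := P.J_mem_perpGrading hs hjs
  generalize P.J s = u at hm
  induction hm using Submodule.span_induction with
  | zero => simp
  | add x y _ _ hx hy => rw [map_add, map_add, add_add_add_comm, hx, hy, add_zero]
  | smul c x _ hx => rw [map_smul, map_smul, ← smul_add, hx, smul_zero]
  | mem u hu =>
    obtain ⟨a, b, -, ω, -, ξ, hξ, rfl⟩ := hu
    rw [LinearMap.rTensor_tmul, signedExtension_tmul, LinearMap.comp_apply, LinearMap.comp_apply,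
      hJ b ξ hξ]
    simp

/-- Used for the coefficient `∇₁` of `ħ`, which `J` therefore does not see on sections vanishing
along `A`. -/
theorem J_rTensor_connection_eq_zero {X : O 𝓛 →ₗ[k] O 𝓛}
    (hJX : ∀ d, ∀ s ∈ CSym.deg (dualGrading 𝓛) d, P.j s = 0 → P.J (X s) = 0)
    {D : E →ₗ[k] O 𝓛 ⊗[k] E} (hD : P.j.rTensor E ∘ₗ D = 0)
    {z : O 𝓛 ⊗[k] E} (hz : P.j.rTensor E z = 0) :
    P.J.rTensor E (connection (parL (𝓛 := 𝓛)) X D z) = 0 := by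
  have h : ∀ z, P.J.rTensor E (connection (parL (𝓛 := 𝓛)) X D z) = (P.J ∘ₗ X).rTensor E z +
      signedExtension P.parA (P.J.rTensor E ∘ₗ D) (P.j.rTensor E z) := by
    intro z
    induction z using TensorProduct.induction_on with
    | zero => simp
    | add x y hx hy => simp only [map_add, hx, hy]; abel
    | tmul s e =>
      have h0 : P.j.rTensor E (D e) = 0 := LinearMap.congr_fun hD e
      rw [connection_tmul, map_add, LinearMap.rTensor_tmul, LinearMap.rTensor_tmul,
        LinearMap.rTensor_tmul, J_rTensor_smul, signedExtension_tmul, parL_apply, parA_j, h0,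
        TensorProduct.tmul_zero, map_zero, add_zero]
      rfl
  rw [h, hz, map_zero, add_zero, P.rTensor_eq_zero _ hJX hz]

/-- `J` of a linear operator whose values on `E` vanish along `A`. -/
theorem J_rTensor_linear {R : Module.End k (O 𝓛 ⊗[k] E)} (hR : ∀ (s : O 𝓛) z, R (s • z) = s • R z)
    (hj : ∀ e, P.j.rTensor E (R (1 ⊗ₜ e)) = 0) (z : O 𝓛 ⊗[k] E) :
    P.J.rTensor E (R z) = signedExtension LinearMap.id (P.applyJ R) (P.j.rTensor E z) := by
  induction z using TensorProduct.induction_on with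
  | zero => simp
  | add x y hx hy => simp only [map_add, hx, hy]
  | tmul s e =>
    rw [tmul_eq_smul, hR, J_rTensor_smul, hj, TensorProduct.tmul_zero, map_zero, add_zero,
      ← tmul_eq_smul, LinearMap.rTensor_tmul, signedExtension_tmul]
    rfl

theorem J_rTensor_signedExtension {δ : E →ₗ[k] O 𝓛 ⊗[k] E} (hδ : P.j.rTensor E ∘ₗ δ = 0)
    (z : O 𝓛 ⊗[k] E) :
    P.J.rTensor E (signedExtension (parL (𝓛 := 𝓛)) δ z) =
      signedExtension P.parA (P.J.rTensor E ∘ₗ δ) (P.j.rTensor E z) := by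
  induction z using TensorProduct.induction_on with
  | zero => simp
  | add x y hx hy => simp only [map_add, hx, hy]
  | tmul s e =>
    have h0 : P.j.rTensor E (δ e) = 0 := LinearMap.congr_fun hδ e
    rw [signedExtension_tmul, J_rTensor_smul, h0, TensorProduct.tmul_zero, map_zero, add_zero,
      LinearMap.rTensor_tmul, signedExtension_tmul, parL_apply, parA_j]
    rfl

theorem J_rTensor_comp_mem_cochains {n : ℤ} {Φ : E →ₗ[k] O 𝓛 ⊗[k] E}
    (hΦ : Φ ∈ endTensor (CSym.deg (dualGrading 𝓛)) 𝓔 n) (hj : P.j.rTensor E ∘ₗ Φ = 0) :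
    P.J.rTensor E ∘ₗ Φ ∈ AModule.cochains P 𝓔 n := by
  -- The terms `u ⊗ φ` composing `Φ` need not vanish along `A` one by one. Correcting `J` by the
  -- section of `j` gives an operator that maps all of `O(L)` into `O(A) ⊗ A^⊥` and agrees with `J`
  -- on the values of `Φ`.
  let T : O 𝓛 →ₗ[k] P.OA ⊗[k] Module.Dual k L :=
    P.J ∘ₗ (LinearMap.id - P.lift.toLinearMap ∘ₗ P.j)
  have hT : IsHomogeneousMap (CSym.deg (dualGrading 𝓛)) (AModule.perpGrading P) 0 T := by
    intro d s hs
    rw [add_zero]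
    refine P.J_mem_perpGrading (sub_mem hs (P.lift_mem_deg (P.j_mem_degA hs))) ?_
    change P.j (s - P.lift (P.j s)) = 0
    rw [map_sub, j_lift, sub_self]
  have h := rTensor_comp_mem_endTensor hT hΦ
  have hΦ' : T.rTensor E ∘ₗ Φ = P.J.rTensor E ∘ₗ Φ := by
    ext e
    have h0 : P.j.rTensor E (Φ e) = 0 := LinearMap.congr_fun hj e
    simp only [T, LinearMap.comp_apply, LinearMap.rTensor_comp_apply, LinearMap.rTensor_sub,
      LinearMap.sub_apply, LinearMap.rTensor_id, LinearMap.id_apply, h0, map_zero, sub_zero]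
  rw [hΦ', add_zero] at h
  exact h

end SHLiePair

end SHLie

namespace SHLie

namespace SHLiePair

variable {k L E : Type*} [Field k] [CharZero k] [AddCommGroup L] [Module k L]
  [FiniteDimensional k L] [AddCommGroup E] [Module k E] {𝓛 : ℤ → Submodule k L}
  [DirectSum.Decomposition 𝓛] {P : SHLiePair 𝓛} {𝓔 : ℤ → Submodule k E}

/-! ### Infinitesimal deformations: coefficients of `ħ` -/

section Deformation

variable {Qp : O 𝓛 →ₗ[k] O 𝓛} (h : P.IsCompatibleDeformation Qp)
include h

theorem IsCompatibleDeformation.j_eq_zero (s : O 𝓛) : P.j (Qp s) = 0 := by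
  simpa [epsMap, act, deformed] using
    congrArg TrivSqZeroExt.snd (LinearMap.congr_fun h.restrict (eps s 0))

theorem IsCompatibleDeformation.comm (s : O 𝓛) : P.Q (Qp s) + Qp (P.Q s) = 0 := by
  simpa [deformed] using LinearMap.congr_fun (congrArg TrivSqZeroExt.snd h.square_zero) s

theorem IsCompatibleDeformation.J_gen_eq_zero (ξ : Module.Dual k L)
    (hξ : ξ ∈ P.A.dualAnnihilator) : P.J (Qp (O.gen 𝓛 ξ)) = 0 := by
  simpa [epsMap, act, deformed] using
    congrArg TrivSqZeroExt.snd (h.module (eps ξ 0) ⟨by simpa using hξ, by simp⟩)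

/-- Keeping the structure of `A` fixed gives `j ∘ Q₊ = 0`, and keeping the module `B` fixed gives `J
∘ Q₊ = 0` on `A^⊥`. These are the hypotheses of `J_derivation_eq_zero`. -/
theorem IsCompatibleDeformation.J_eq_zero (d : ℤ) (s : O 𝓛)
    (hs : s ∈ CSym.deg (dualGrading 𝓛) d) (hjs : P.j s = 0) : P.J (Qp s) = 0 :=
  P.J_derivation_eq_zero h.derivation h.j_eq_zero (fun _ ξ hξ => h.J_gen_eq_zero ξ hξ.2) hs hjs

end Deformation

omit [CharZero k] [FiniteDimensional k L] in
theorem Q_Q (s : O 𝓛) : P.Q (P.Q s) = 0 := LinearMap.congr_fun P.isHomological.square_zero s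

theorem fst_atiyahCocycle (Qp : O 𝓛 →ₗ[k] O 𝓛) (D : DualNumber (E →ₗ[k] O 𝓛 ⊗[k] E)) :
    (P.atiyahCocycle (P.deformed Qp) D).fst =
      P.applyJ (connection (parL (𝓛 := 𝓛)) P.Q D.fst * connection (parL (𝓛 := 𝓛)) P.Q D.fst) := by
  simp [atiyahCocycle, hConnection, deformed, epsMap, act]

theorem snd_atiyahCocycle (Qp : O 𝓛 →ₗ[k] O 𝓛) (D : DualNumber (E →ₗ[k] O 𝓛 ⊗[k] E)) :
    (P.atiyahCocycle (P.deformed Qp) D).snd =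
      P.applyJ (connection (parL (𝓛 := 𝓛)) P.Q D.fst * connection (parL (𝓛 := 𝓛)) Qp D.snd +
        connection (parL (𝓛 := 𝓛)) Qp D.snd * connection (parL (𝓛 := 𝓛)) P.Q D.fst) := by
  simp [atiyahCocycle, hConnection, deformed, epsMap, act]

theorem applyJ_apply (R : Module.End k (O 𝓛 ⊗[k] E)) (e : E) :
    P.applyJ R e = P.J.rTensor E (R (1 ⊗ₜ e)) := rfl

theorem fst_atiyahCocycle_apply (Qp : O 𝓛 →ₗ[k] O 𝓛) (D : DualNumber (E →ₗ[k] O 𝓛 ⊗[k] E))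
    (e : E) : (P.atiyahCocycle (P.deformed Qp) D).fst e =
      P.J.rTensor E (connection (parL (𝓛 := 𝓛)) P.Q D.fst (D.fst e)) := by
  rw [fst_atiyahCocycle, applyJ_apply, Module.End.mul_apply,
    connection_one_tmul P.isHomological.derivation]

theorem snd_atiyahCocycle_apply {Qp : O 𝓛 →ₗ[k] O 𝓛} (hQp : IsDerivation 𝓛 1 Qp)
    (D : DualNumber (E →ₗ[k] O 𝓛 ⊗[k] E)) (e : E) :
    (P.atiyahCocycle (P.deformed Qp) D).snd e =
      P.J.rTensor E (connection (parL (𝓛 := 𝓛)) P.Q D.fst (D.snd e)) +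
        P.J.rTensor E (connection (parL (𝓛 := 𝓛)) Qp D.snd (D.fst e)) := by
  rw [snd_atiyahCocycle, applyJ_apply, LinearMap.add_apply, Module.End.mul_apply,
    Module.End.mul_apply, connection_one_tmul P.isHomological.derivation, connection_one_tmul hQp,
    map_add]

variable {M : P.AModule 𝓔} {D D' : DualNumber (E →ₗ[k] O 𝓛 ⊗[k] E)}
  {Qp Qp' : O 𝓛 →ₗ[k] O 𝓛}

theorem AModule.ceDiff_two_apply (Ψ : E →ₗ[k] (P.OA ⊗[k] Module.Dual k L) ⊗[k] E) (e : E) :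
    M.ceDiff 2 Ψ e = M.tensorDiff (Ψ e) - signedExtension LinearMap.id Ψ (M.D e) := by
  simp [ceDiff]

theorem AModule.ceDiff_one_apply (Ψ : E →ₗ[k] (P.OA ⊗[k] Module.Dual k L) ⊗[k] E) (e : E) :
    M.ceDiff 1 Ψ e = M.tensorDiff (Ψ e) + signedExtension P.parA Ψ (M.D e) := by
  simp [ceDiff]

variable (M) in
omit [CharZero k] [FiniteDimensional k L] in
-- Lift the coefficients of `D^E` through the section of `O(L) → O(A)` and take the `ħ`-part to be
-- zero.
theorem AModule.exists_isExtension : ∃ D, M.IsExtension D := by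
  refine ⟨eps (P.lift.toLinearMap.rTensor E ∘ₗ M.D) 0, ?_, by simp, ?_, by simp⟩
  · have hl : IsHomogeneousMap P.degA (CSym.deg (dualGrading 𝓛)) 0 P.lift.toLinearMap :=
      fun n v hv => by rw [add_zero]; exact P.lift_mem_deg hv
    simpa using rTensor_comp_mem_endTensor hl M.degree
  · rw [fst_eps, ← LinearMap.comp_assoc, ← LinearMap.rTensor_comp, j_comp_lift,
      LinearMap.rTensor_id, LinearMap.id_comp]

omit [CharZero k] [FiniteDimensional k L] in
theorem AModule.connection_D (e : E) : connection P.parA P.QA M.D (M.D e) = 0 := by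
  have h := LinearMap.congr_fun M.flat (1 ⊗ₜ e)
  have h1 : P.QA 1 = 0 := by
    have : P.j 1 = 1 := map_one (restrictO 𝓛 P.A)
    rw [← this, ← j_Q, P.isHomological.derivation.map_one, map_zero]
  have h2 : P.parA 1 = 1 := map_one (O.pullback _ P.restrict_parity_mem)
  rw [LinearMap.comp_apply, connection_tmul, h1, h2] at h
  simpa using h

omit [CharZero k] [FiniteDimensional k L] in
theorem connection_add (X : O 𝓛 →ₗ[k] O 𝓛) (F δ : E →ₗ[k] O 𝓛 ⊗[k] E)
    (z : O 𝓛 ⊗[k] E) : connection (parL (𝓛 := 𝓛)) X (F + δ) z =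
      connection (parL (𝓛 := 𝓛)) X F z + signedExtension (parL (𝓛 := 𝓛)) δ z := by
  induction z using TensorProduct.induction_on with
  | zero => simp
  | add x y hx hy => simp only [map_add, hx, hy]; abel
  | tmul s e =>
    rw [connection_tmul, connection_tmul, signedExtension_tmul, LinearMap.add_apply, smul_add,
      add_assoc]

/-! ### Bianchi identity and independence of the connection -/

namespace AModule.IsExtension

variable (hD : M.IsExtension D)
include hD

omit [CharZero k] [FiniteDimensional k L] in
theorem j_curvature (e : E) :
    P.j.rTensor E (connection (parL (𝓛 := 𝓛)) P.Q D.fst (D.fst e)) = 0 := by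
  rw [P.j_rTensor_connection P.j_Q, hD.restrict_fst]
  have : P.j.rTensor E (D.fst e) = M.D e := LinearMap.congr_fun hD.restrict_fst e
  rw [this, connection_D]

omit [CharZero k] [FiniteDimensional k L] in
theorem j_snd (e : E) : P.j.rTensor E (D.snd e) = 0 := LinearMap.congr_fun hD.restrict_snd e

omit [CharZero k] [FiniteDimensional k L] in
theorem j_fst (e : E) : P.j.rTensor E (D.fst e) = M.D e := LinearMap.congr_fun hD.restrict_fst e

theorem j_connection_snd (hQp : P.IsCompatibleDeformation Qp) (z : O 𝓛 ⊗[k] E) :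
    P.j.rTensor E (connection (parL (𝓛 := 𝓛)) Qp D.snd z) = 0 := by
  rw [P.j_rTensor_connection (Y := 0) (by simpa using hQp.j_eq_zero), hD.restrict_snd]
  induction P.j.rTensor E z using TensorProduct.induction_on with
  | zero => simp
  | add x y hx hy => rw [map_add, hx, hy, add_zero]
  | tmul s e => rw [connection_tmul]; simp

omit [CharZero k] [FiniteDimensional k L] hD in
theorem j_connection_fst {z : O 𝓛 ⊗[k] E} (hz : P.j.rTensor E z = 0) :
    P.j.rTensor E (connection (parL (𝓛 := 𝓛)) P.Q D.fst z) = 0 := by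
  rw [P.j_rTensor_connection P.j_Q, hz, map_zero]

/-- The hypothesis `hB` is the Bianchi identity after `J`. Since `R(1 ⊗ e)` vanishes along `A`, its
left side is `tensorDiff` of `J R(1 ⊗ e)`; since `R` is `O(L)`-linear, its right side depends only
on `D^E e`. Both orders in `ħ` use this criterion with the same `∇₀`. -/
theorem ceDiff_applyJ_eq_zero {R : Module.End k (O 𝓛 ⊗[k] E)}
    (hR : ∀ (s : O 𝓛) z, R (s • z) = s • R z) (hj : ∀ e, P.j.rTensor E (R (1 ⊗ₜ e)) = 0)
    (hB : ∀ e, P.J.rTensor E (connection (parL (𝓛 := 𝓛)) P.Q D.fst (R (1 ⊗ₜ e))) =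
      P.J.rTensor E (R (D.fst e))) : M.ceDiff 2 (P.applyJ R) = 0 :=
  LinearMap.ext fun e => by
    have h1 := J_rTensor_linear hR hj (D.fst e)
    have h2 := J_rTensor_connection M hD.restrict_fst (R (1 ⊗ₜ e))
    rw [hD.j_fst] at h1
    rw [hj, map_zero, add_zero, hB, h1] at h2
    rw [ceDiff_two_apply, applyJ_apply, h2, sub_self]
    rfl

/-- The curvature is `O(L)`-linear with values vanishing along `A`, so the product rule makes `J(∇₀²
z)` depend only on the restriction of `z`. -/
theorem J_curvature_eq_zero {z : O 𝓛 ⊗[k] E} (hz : P.j.rTensor E z = 0) :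
    P.J.rTensor E (connection (parL (𝓛 := 𝓛)) P.Q D.fst
      (connection (parL (𝓛 := 𝓛)) P.Q D.fst z)) = 0 := by
  have h := J_rTensor_linear (P := P) (R := connection (parL (𝓛 := 𝓛)) P.Q D.fst *
    connection (parL (𝓛 := 𝓛)) P.Q D.fst)
    (fun s z => connection_sq_smul P.isHomological.derivation Q_Q D.fst s z)
    (fun e => by
      rw [Module.End.mul_apply, connection_one_tmul P.isHomological.derivation, hD.j_curvature]) z
  rwa [hz, map_zero] at h

theorem j_snd_curvature (hQp : P.IsCompatibleDeformation Qp) (e : E) :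
    P.j.rTensor E (connection (parL (𝓛 := 𝓛)) P.Q D.fst (D.snd e) +
      connection (parL (𝓛 := 𝓛)) Qp D.snd (D.fst e)) = 0 := by
  rw [map_add, j_connection_fst (hD.j_snd e), hD.j_connection_snd hQp, add_zero]

theorem fst_atiyahCocycle_mem :
    (P.atiyahCocycle (P.deformed Qp) D).fst ∈ cocycles (cochains P 𝓔) M.ceDiff 2 := by
  have hQ := P.isHomological.derivation
  rw [fst_atiyahCocycle]
  refine ⟨?_, hD.ceDiff_applyJ_eq_zero (connection_sq_smul hQ Q_Q D.fst)
    (fun e => ?_) fun e => ?_⟩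
  · have h : P.applyJ (connection (parL (𝓛 := 𝓛)) P.Q D.fst *
        connection (parL (𝓛 := 𝓛)) P.Q D.fst) =
        P.J.rTensor E ∘ₗ connection (parL (𝓛 := 𝓛)) P.Q D.fst ∘ₗ D.fst := LinearMap.ext fun e => by
      rw [applyJ_apply, Module.End.mul_apply, connection_one_tmul hQ]; rfl
    have hm := connection_comp_mem_endTensor hQ.degree hD.degree_fst hD.degree_fst
    rw [one_add_one_eq_two] at hm
    rw [h]
    exact J_rTensor_comp_mem_cochains hm (LinearMap.ext hD.j_curvature)
  · rw [Module.End.mul_apply, connection_one_tmul hQ, hD.j_curvature]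
  · rw [Module.End.mul_apply, Module.End.mul_apply, connection_one_tmul hQ]

theorem snd_atiyahCocycle_mem (hQp : P.IsCompatibleDeformation Qp) :
    (P.atiyahCocycle (P.deformed Qp) D).snd ∈ cocycles (cochains P 𝓔) M.ceDiff 2 := by
  have hQ := P.isHomological.derivation
  have hP := hQp.derivation
  rw [snd_atiyahCocycle]
  have h : ∀ e, (connection (parL (𝓛 := 𝓛)) P.Q D.fst * connection (parL (𝓛 := 𝓛)) Qp D.snd +
      connection (parL (𝓛 := 𝓛)) Qp D.snd * connection (parL (𝓛 := 𝓛)) P.Q D.fst) (1 ⊗ₜ e) =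
      connection (parL (𝓛 := 𝓛)) P.Q D.fst (D.snd e) +
        connection (parL (𝓛 := 𝓛)) Qp D.snd (D.fst e) := fun e => by
    rw [LinearMap.add_apply, Module.End.mul_apply, Module.End.mul_apply, connection_one_tmul hQ,
      connection_one_tmul hP]
  refine ⟨?_, hD.ceDiff_applyJ_eq_zero (connection_comm_smul hQ hP hQp.comm D.fst D.snd)
    (fun e => ?_) fun e => ?_⟩
  · have h' : P.applyJ (connection (parL (𝓛 := 𝓛)) P.Q D.fst * connection (parL (𝓛 := 𝓛)) Qp D.snd +
        connection (parL (𝓛 := 𝓛)) Qp D.snd * connection (parL (𝓛 := 𝓛)) P.Q D.fst) =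
        P.J.rTensor E ∘ₗ (connection (parL (𝓛 := 𝓛)) P.Q D.fst ∘ₗ D.snd +
          connection (parL (𝓛 := 𝓛)) Qp D.snd ∘ₗ D.fst) := LinearMap.ext fun e => by
      rw [applyJ_apply, h]; rfl
    have hm := add_mem (connection_comp_mem_endTensor hQ.degree hD.degree_fst hD.degree_snd)
      (connection_comp_mem_endTensor hP.degree hD.degree_snd hD.degree_fst)
    rw [one_add_one_eq_two] at hm
    rw [h']
    exact J_rTensor_comp_mem_cochains hm (LinearMap.ext (hD.j_snd_curvature hQp))
  · rw [h, hD.j_snd_curvature hQp]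
  -- Compare `∇₀R₁` with `R₁∇₀` on `1 ⊗ e`: the term `∇₀∇₁D₀e` is common, `J(∇₀²D₁e) = 0` because
  -- `D₁` vanishes along `A`, and `J(∇₁∇₀D₀e) = 0` because the curvature `∇₀D₀e` does.
  · have h1 := J_rTensor_connection_eq_zero (P := P) hQp.J_eq_zero hD.restrict_snd
      (hD.j_curvature e)
    rw [h, map_add, map_add, hD.J_curvature_eq_zero (hD.j_snd e), zero_add, LinearMap.add_apply,
      Module.End.mul_apply, Module.End.mul_apply, map_add, h1, add_zero]

/-- The Atiyah cocycle of an extension is a cocycle of degree two. -/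
theorem atiyahCocycle_mem (hQp : P.IsCompatibleDeformation Qp) :
    P.atiyahCocycle (P.deformed Qp) D ∈ cocycles (epsC (cochains P 𝓔)) (epsD M.ceDiff) 2 :=
  (mem_cocycles_eps _ _).2 ⟨hD.fst_atiyahCocycle_mem, hD.snd_atiyahCocycle_mem hQp⟩

theorem J_connection_eq_tensorDiff {z : O 𝓛 ⊗[k] E} (hz : P.j.rTensor E z = 0) :
    P.J.rTensor E (connection (parL (𝓛 := 𝓛)) P.Q D.fst z) = M.tensorDiff (P.J.rTensor E z) := by
  rw [J_rTensor_connection M hD.restrict_fst, hz, map_zero, add_zero]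

/-- The Atiyah cocycles of two extensions are cohomologous. -/
theorem atiyahCocycle_sub_mem (hD' : M.IsExtension D') (hQp : P.IsCompatibleDeformation Qp) :
    P.atiyahCocycle (P.deformed Qp) D' - P.atiyahCocycle (P.deformed Qp) D ∈
      coboundaries (epsC (cochains P 𝓔)) (epsD M.ceDiff) 2 := by
  have hP := hQp.derivation
  obtain ⟨δ₀, h0⟩ : ∃ δ, D'.fst = D.fst + δ := ⟨D'.fst - D.fst, by abel⟩
  obtain ⟨δ₁, h1⟩ : ∃ δ, D'.snd = D.snd + δ := ⟨D'.snd - D.snd, by abel⟩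
  have hδ₀ : P.j.rTensor E ∘ₗ δ₀ = 0 := by
    have h := hD'.restrict_fst
    rwa [h0, LinearMap.comp_add, hD.restrict_fst, add_eq_left] at h
  have hδ₁ : P.j.rTensor E ∘ₗ δ₁ = 0 := by
    have h := hD'.restrict_snd
    rwa [h1, LinearMap.comp_add, hD.restrict_snd, zero_add] at h
  have hm₀ : δ₀ ∈ endTensor (CSym.deg (dualGrading 𝓛)) 𝓔 1 := by
    rw [← add_sub_cancel_left D.fst δ₀, ← h0]
    exact sub_mem hD'.degree_fst hD.degree_fst
  have hm₁ : δ₁ ∈ endTensor (CSym.deg (dualGrading 𝓛)) 𝓔 1 := by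
    rw [← add_sub_cancel_left D.snd δ₁, ← h1]
    exact sub_mem hD'.degree_snd hD.degree_snd
  have hj₀ : ∀ e, P.j.rTensor E (δ₀ e) = 0 := LinearMap.congr_fun hδ₀
  rw [mem_coboundaries_eps, TrivSqZeroExt.fst_sub, TrivSqZeroExt.snd_sub]
  -- The second term is evaluated on `D'₀` rather than `D₀`; both restrict to `D^E`. With `D'₀` it
  -- already contains the quadratic term `δ₀²` of the new curvature.
  have h₂ : ∀ {δ : E →ₗ[k] O 𝓛 ⊗[k] E} (hδ : P.j.rTensor E ∘ₗ δ = 0) (e : E),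
      M.ceDiff 1 (P.J.rTensor E ∘ₗ δ) e =
        P.J.rTensor E (connection (parL (𝓛 := 𝓛)) P.Q D.fst (δ e)) +
          P.J.rTensor E (signedExtension (parL (𝓛 := 𝓛)) δ (D'.fst e)) := fun hδ e => by
    rw [hD.J_connection_eq_tensorDiff (LinearMap.congr_fun hδ e), J_rTensor_signedExtension hδ,
      hD'.j_fst, ceDiff_one_apply]
    rfl
  refine ⟨⟨P.J.rTensor E ∘ₗ δ₀, J_rTensor_comp_mem_cochains hm₀ hδ₀, LinearMap.ext fun e => ?_⟩,
    ⟨P.J.rTensor E ∘ₗ δ₁, J_rTensor_comp_mem_cochains hm₁ hδ₁, LinearMap.ext fun e => ?_⟩⟩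
  · have h₃ : P.J.rTensor E (connection (parL (𝓛 := 𝓛)) P.Q D'.fst (D'.fst e)) =
        P.J.rTensor E (connection (parL (𝓛 := 𝓛)) P.Q D.fst (D.fst e)) +
          P.J.rTensor E (connection (parL (𝓛 := 𝓛)) P.Q D.fst (δ₀ e)) +
            P.J.rTensor E (signedExtension (parL (𝓛 := 𝓛)) δ₀ (D'.fst e)) := by
      rw [← map_add, ← map_add, ← map_add, ← LinearMap.add_apply, ← h0, ← connection_add, ← h0]
    refine (h₂ hδ₀ e).trans ?_
    rw [LinearMap.sub_apply, fst_atiyahCocycle_apply, fst_atiyahCocycle_apply, h₃]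
    abel
  -- Replacing `D'₀` by `D₀` in the outer connection costs `J(δ₀(D'₁e))`, which is zero since `D'₁`
  -- vanishes along `A`.
  · have h₃ : P.J.rTensor E (connection (parL (𝓛 := 𝓛)) P.Q D'.fst (D'.snd e)) =
        P.J.rTensor E (connection (parL (𝓛 := 𝓛)) P.Q D.fst (D.snd e)) +
          P.J.rTensor E (connection (parL (𝓛 := 𝓛)) P.Q D.fst (δ₁ e)) := by
      have h := J_rTensor_signedExtension hδ₀ (D'.snd e)
      rw [hD'.j_snd, map_zero] at h
      rw [← map_add, ← map_add, ← LinearMap.add_apply, ← h1, h0, connection_add, map_add, h,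
        add_zero]
    -- Here `δ₀` enters only through `J(∇₁(δ₀e))`, which is zero by compatibility of `Q₊`, so only
    -- `δ₁` contributes.
    have h₄ : P.J.rTensor E (connection (parL (𝓛 := 𝓛)) Qp D'.snd (D'.fst e)) =
        P.J.rTensor E (connection (parL (𝓛 := 𝓛)) Qp D.snd (D.fst e)) +
          P.J.rTensor E (signedExtension (parL (𝓛 := 𝓛)) δ₁ (D'.fst e)) := by
      have h := J_rTensor_connection_eq_zero (P := P) hQp.J_eq_zero hD.restrict_snd (hj₀ e)
      have h' : P.J.rTensor E (connection (parL (𝓛 := 𝓛)) Qp D.snd (D'.fst e)) =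
          P.J.rTensor E (connection (parL (𝓛 := 𝓛)) Qp D.snd (D.fst e)) := by
        rw [h0, LinearMap.add_apply, map_add, map_add, h, add_zero]
      rw [← h', h1, connection_add, map_add]
    refine (h₂ hδ₁ e).trans ?_
    rw [LinearMap.sub_apply, snd_atiyahCocycle_apply hP, snd_atiyahCocycle_apply hP, h₃, h₄]
    abel

end AModule.IsExtension

omit [CharZero k] [FiniteDimensional k L] in
theorem dualMap_mkQ_mem (𝓛 : ℤ → Submodule k L) (A : Submodule k L) (n : ℤ)
    (ξ : Module.Dual k (L ⧸ A)) (hξ : ξ ∈ dualGrading (quotientGrading 𝓛 A) n) :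
    A.mkQ.dualMap ξ ∈ dualGrading 𝓛 n :=
  dualMap_mem_dualGrading A.mkQ (fun _ _ hv => Submodule.mem_map_of_mem hv) n ξ hξ

omit [CharZero k] [FiniteDimensional k L] in
theorem coeff_inflateO (𝓛 : ℤ → Submodule k L) (A : Submodule k L) (i : ℕ)
    (s : O (quotientGrading 𝓛 A)) : CSym.coeff (dualGrading 𝓛) i (inflateO 𝓛 A s) =
      GSym.map A.mkQ.dualMap (dualMap_mkQ_mem 𝓛 A)
        (CSym.coeff (dualGrading (quotientGrading 𝓛 A)) i s) :=
  CSym.coeff_map _ _ i s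

/-! ### Gauge transformations -/

section Gauge

variable {Λ : O 𝓛 →ₗ[k] O 𝓛} (hΛ : P.IsGaugeEquivalence Λ)
include hΛ

omit [CharZero k] [FiniteDimensional k L] in
-- The Leibniz rule is the coefficient of `ħ` in `σ(xy) = σ(x)σ(y)`.
theorem IsGaugeEquivalence.isDerivation : IsDerivation 𝓛 0 Λ where
  degree := hΛ.degree
  leibniz d x _ y := by
    have h := congrArg TrivSqZeroExt.snd (hΛ.map_mul (eps x 0) (eps y 0))
    simp only [act, gauge, LinearMap.coe_mk, AddHom.coe_mk] at h
    simpa [add_comm] using h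

omit [CharZero k] [FiniteDimensional k L] in
theorem IsGaugeEquivalence.j_eq_zero (s : O 𝓛) : P.j (Λ s) = 0 := by
  simpa [epsMap, act, gauge] using
    congrArg TrivSqZeroExt.snd (LinearMap.congr_fun hΛ.restrict (eps s 0))

omit [CharZero k] [FiniteDimensional k L] in
theorem IsGaugeEquivalence.map_inflate (s : O (quotientGrading 𝓛 P.A)) :
    Λ (inflateO 𝓛 P.A s) = 0 := by
  simpa [epsMap, act, gauge] using
    congrArg TrivSqZeroExt.snd (LinearMap.congr_fun hΛ.inflate (eps s 0))

omit [CharZero k] in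
theorem IsGaugeEquivalence.map_gen_eq_zero {n : ℤ} {ξ : Module.Dual k L}
    (hξ : ξ ∈ dualGrading 𝓛 n) (hA : ξ ∈ P.A.dualAnnihilator) : Λ (O.gen 𝓛 ξ) = 0 := by
  rw [Submodule.mem_dualAnnihilator] at hA
  let η : Module.Dual k (L ⧸ P.A) := P.A.liftQ ξ hA
  have hη : η ∈ dualGrading (quotientGrading 𝓛 P.A) n := by
    rintro m hm _ ⟨v, hv, rfl⟩
    exact hξ m hm v hv
  -- The generator of `O(B)` attached to `η` is built from its coefficients, since `O.gen` would
  -- require a decomposition of the quotient grading.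
  obtain ⟨s, -, hs⟩ := CSym.exists_coeff_eq (𝓥 := dualGrading (quotientGrading 𝓛 P.A)) (d := n)
    (fun i => if i = 1 then GSym.ι _ η else 0) (fun i => by
      split_ifs with h
      · rw [h]; exact GSym.ι_mem_piece hη
      · exact zero_mem _)
  have this : O.gen 𝓛 ξ = inflateO 𝓛 P.A s := CSym.ext_coeff fun i => by
    rw [O.coeff_gen, coeff_inflateO, hs]
    split_ifs
    · rw [GSym.map_ι]
      rfl
    · rw [map_zero]
  rw [this, hΛ.map_inflate]

theorem IsGaugeEquivalence.J_eq_zero (d : ℤ) (s : O 𝓛)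
    (hs : s ∈ CSym.deg (dualGrading 𝓛) d) (hjs : P.j s = 0) : P.J (Λ s) = 0 :=
  P.J_derivation_eq_zero hΛ.isDerivation hΛ.j_eq_zero
    (fun _ ξ hξ => by rw [hΛ.map_gen_eq_zero hξ.1 hξ.2, map_zero]) hs hjs

omit [CharZero k] [FiniteDimensional k L] in
theorem IsGaugeEquivalence.rTensor_smul (s : O 𝓛) (z : O 𝓛 ⊗[k] E) :
    Λ.rTensor E (s • z) = Λ s • z + s • Λ.rTensor E z := by
  induction z using TensorProduct.induction_on with
  | zero => simp
  | add x y hx hy => simp only [smul_add, map_add, hx, hy]; abel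
  | tmul t e =>
    simp only [TensorProduct.smul_tmul', smul_eq_mul, LinearMap.rTensor_tmul,
      hΛ.isDerivation.map_mul, O.parPow_of_even 𝓛 Even.zero, TensorProduct.add_tmul]

omit [CharZero k] [FiniteDimensional k L] in
/-- The gauge transform `σ ∘ D ∘ σ⁻¹` of an extension. -/
theorem IsGaugeEquivalence.isExtension (hD : M.IsExtension D) :
    M.IsExtension (eps D.fst (D.snd + Λ.rTensor E ∘ₗ D.fst)) := by
  refine ⟨by simpa using hD.degree_fst, ?_, by simpa using hD.restrict_fst, ?_⟩
  · rw [snd_eps]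
    exact add_mem hD.degree_snd (by simpa using rTensor_comp_mem_endTensor hΛ.degree hD.degree_fst)
  · have : P.j ∘ₗ Λ = 0 := LinearMap.ext hΛ.j_eq_zero
    rw [snd_eps, LinearMap.comp_add, hD.restrict_snd, zero_add, ← LinearMap.comp_assoc,
      ← LinearMap.rTensor_comp, this, LinearMap.rTensor_zero, LinearMap.zero_comp]

omit [CharZero k] [FiniteDimensional k L] in
-- This is the coefficient of `ħ` in `σ∇σ⁻¹`, namely `∇₁ + Λ∇₀ - ∇₀Λ`; `hg` is the same relation
-- between the vector fields.
theorem IsGaugeEquivalence.connection_eq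
    (hg : ∀ s, Qp' s = Qp s + Λ (P.Q s) - P.Q (Λ s)) (F G : E →ₗ[k] O 𝓛 ⊗[k] E)
    (z : O 𝓛 ⊗[k] E) :
    connection (parL (𝓛 := 𝓛)) Qp' (G + Λ.rTensor E ∘ₗ F) z =
      connection (parL (𝓛 := 𝓛)) Qp G z + Λ.rTensor E (connection (parL (𝓛 := 𝓛)) P.Q F z) -
        connection (parL (𝓛 := 𝓛)) P.Q F (Λ.rTensor E z) := by
  induction z using TensorProduct.induction_on with
  | zero => simp
  | add x y hx hy => simp only [map_add, hx, hy]; abel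
  | tmul s e =>
    have hp : Λ (O.par 𝓛 s) = O.par 𝓛 (Λ s) := by
      simpa [O.parPow_one] using hΛ.isDerivation.map_parPow 1 s
    simp only [connection_tmul, map_add, LinearMap.rTensor_tmul, hΛ.rTensor_smul, hg, parL_apply, hp,
      TensorProduct.add_tmul, TensorProduct.sub_tmul, LinearMap.add_apply, LinearMap.comp_apply,
      smul_add]
    abel

/-- The Atiyah cocycle does not change under gauge transformations. -/
theorem IsGaugeEquivalence.atiyahCocycle_eq (hQp : P.IsCompatibleDeformation Qp)
    (hQp' : P.IsCompatibleDeformation Qp') (hD : M.IsExtension D)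
    (hg : ∀ s, Qp' s = Qp s + Λ (P.Q s) - P.Q (Λ s)) :
    P.atiyahCocycle (P.deformed Qp') (eps D.fst (D.snd + Λ.rTensor E ∘ₗ D.fst)) =
      P.atiyahCocycle (P.deformed Qp) D := by
  apply TrivSqZeroExt.ext
  · rw [fst_atiyahCocycle, fst_atiyahCocycle, fst_eps]
  · refine LinearMap.ext fun e => ?_
    rw [snd_atiyahCocycle_apply hQp.derivation, snd_atiyahCocycle_apply hQp'.derivation, fst_eps,
      snd_eps, hΛ.connection_eq hg, LinearMap.add_apply, LinearMap.comp_apply, map_add, map_add,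
      map_sub, map_add]
    -- The terms `∇₀ΛD₀e` from the new `D₁` and from the commutator cancel; only `Λ` applied to the
    -- curvature is left, and the curvature vanishes along `A`.
    have h : P.J.rTensor E (Λ.rTensor E (connection (parL (𝓛 := 𝓛)) P.Q D.fst (D.fst e))) = 0 := by
      rw [← LinearMap.rTensor_comp_apply]
      exact P.rTensor_eq_zero _ hΛ.J_eq_zero (hD.j_curvature e)
    rw [h]
    abel

end Gauge

end SHLiePair

end SHLie

theorem theorem4p3 {k L E : Type*} [Field k] [CharZero k]
    [AddCommGroup L] [Module k L] [FiniteDimensional k L] [AddCommGroup E] [Module k E]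
    (𝓛 : ℤ → Submodule k L) [DirectSum.Decomposition 𝓛]
    (𝓔 : ℤ → Submodule k E) [DirectSum.Decomposition 𝓔]
    (P : SHLie.SHLiePair 𝓛) (M : P.AModule 𝓔) (Qp Qp' : SHLie.O 𝓛 →ₗ[k] SHLie.O 𝓛)
    (hQp : P.IsCompatibleDeformation Qp) (hQp' : P.IsCompatibleDeformation Qp')
    (hgauge : P.GaugeEquivalent Qp Qp') :
    ∃ c : DualNumber (M.H 2),
      SHLie.SHLiePair.IsAtiyahClass M Qp c ∧ SHLie.SHLiePair.IsAtiyahClass M Qp' c := by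
  obtain ⟨D, hD⟩ := M.exists_isExtension
  obtain ⟨Λ, hΛ, hσ⟩ := hgauge
  -- The coefficient of `ħ` in `σQ(ħ) = Q̄(ħ)σ`.
  have hg : ∀ s, Qp' s = Qp s + Λ (P.Q s) - P.Q (Λ s) := fun s => by
    have h := LinearMap.congr_fun (congrArg TrivSqZeroExt.snd hσ) s
    simp [SHLie.SHLiePair.gauge, SHLie.SHLiePair.deformed] at h
    rw [h]
    abel
  have hα := hΛ.atiyahCocycle_eq hQp hQp' hD hg
  refine ⟨SHLie.cohomologyEps _ _ 2 (Submodule.Quotient.mk ⟨_, hD.atiyahCocycle_mem hQp⟩),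
    ⟨⟨D, hD⟩, fun D' hD' => ⟨hD'.atiyahCocycle_mem hQp, ?_⟩⟩,
    ⟨⟨D, hD⟩, fun D' hD' => ⟨hD'.atiyahCocycle_mem hQp', ?_⟩⟩⟩
  · congr 1
    exact (Submodule.Quotient.eq _).2 (hD.atiyahCocycle_sub_mem hD' hQp)
  · congr 1
    refine (Submodule.Quotient.eq _).2 ?_
    -- Connections over the second deformation are compared with the gauge transform of `D`, whose
    -- cocycle equals that of `D` over the first.
    have h := (hΛ.isExtension hD).atiyahCocycle_sub_mem hD' hQp'
    rw [hα] at h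
    exact h
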